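/- Conventions. An algorithm is a deterministic multi-tape Turing machine. A time-complexity class $\mathcal C$ is given by a family $\mathcal F$ of non-decreasing functions $f:\mathbb N\to\mathbb N$ with $f(n)\ge n$, closed under $f\mapsto \bigl(n\mapsto C f(Cn+C)+C\bigr)$ for every integer $C\ge 1$; a language $L$ over a finite alphabet $X$ is in $\mathcal C$ if for some $f\in\mathcal F$ some machine decides $L$ in at most $f(|w|)$ steps on every $w\in X^*$. A function $f:\mathbb N\to[0,\infty)$ is subexponential if $f(n)/r^n\to 0$ for every $r>1$; $\mathrm{SubExp}$ is the class of languages decidable in time bounded by a subexponential function. A finite generating set of a group $G$ is a finite set $A$ with a map $\pi:A\to G$ whose image generates $G$; the word problem of $G$ relative to $A$ is the language $WP(G,A)\subseteq (A\cup A^{-1})^*$ of all words representing $1\in G$. The word problem of $G$ is in a class if $WP(G,A)$ is in it for some finite generating set $A$. For $v$ in the free group $F(A)$, $|v|$ is the length of the freely reduced word representing $v$. A discrete probability measure $\mu:F(A)\to[0,1]$ is length-invariant if $\mu(u)=\mu(v)$ whenever $|u|=|v|$. Theorem E. Let $G$ be a finitely presented group whose word problem is in $\mathrm{SubExp}$,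 and let $\mathcal C\subseteq\mathrm{SubExp}$ be a time-complexity class given by the family $\mathcal F$. Suppose that $G$ has a subgroup of finite index which possesses a non-amenable quotient group $\bar G$ whose word problem is in $\mathcal C$. Then for every finite generating set $A$ of $G$ the word problem of $G$, with elements of $F(A)$ as inputs, is solvable with average-case time-complexity in $\mathcal C$, uniformly relative to the family of all length-invariant discrete probability measures on $F(A)$. That is, there are a machine $M$ that decides $WP(G,A)$, a positive function $f\in\mathcal F$ and a constant $0<K<\infty$ such that for every length-invariant discrete probability measure $\mu$ on $F(A)$ $$\sum_{v\in F(A)}\frac{T(v)}{f(|v|)}\,\mu(v)\le K,$$ where $T(v)$ is the number of steps of $M$ on the freely reduced word representing $v$. -/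

import Mathlib

open scoped NNReal ENNReal symmDiff

/-! ### Deterministic multi-tape Turing machines -/

/-- A deterministic multi-tape Turing machine that accepts or rejects words over `X`.
It has one input tape (index `none`) and finitely many work tapes (indices `some w`). In one step
it reads the scanned symbol on every tape and, depending on these and on its state, passes to a new
state or halts with a verdict, writes one symbol on every tape, and moves every head by at most one
cell. The tapes are unbounded in both directions; `default : Symbol` is the blank. -/
structure MultiTapeTM (X : Type*) where
  /-- the index set of the work tapes -/
  Work : Type
  /-- the tape alphabet -/
  Symbol : Type
  /-- the non-halting states -/
  State : Type
  finiteWork : Finite Work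
  finiteSymbol : Finite Symbol
  finiteState : Finite State
  inhabitedSymbol : Inhabited Symbol
  /-- the initial state -/
  start : State
  /-- input letters as tape symbols -/
  letter : X ↪ Symbol
  letter_ne_blank : ∀ x, letter x ≠ default
  /-- the transition function; the verdict `true` means accept, `false` means reject,
  and the movement `none` means that the head stays where it is -/
  δ : State → (Option Work → Symbol) →
    (State ⊕ Bool) × (Option Work → Symbol × Option Turing.Dir)

attribute [instance] MultiTapeTM.inhabitedSymbol

namespace MultiTapeTM

variable {X : Type*} (M : MultiTapeTM X)

/-- A configuration: a state or a verdict, together with the contents and head positions of the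
tapes. -/
structure Cfg where
  status : M.State ⊕ Bool
  tape : Option M.Work → Turing.Tape M.Symbol

/-- The initial configuration on the input `w`: the word `w` is written on the input tape with the
head on its first letter, and the work tapes are blank. -/
def init (w : List X) : M.Cfg where
  status := Sum.inl M.start
  tape
    | none => Turing.Tape.mk₁ (w.map M.letter)
    | some _ => Turing.Tape.mk₁ []

/-- Write a symbol on a tape, then move the head. -/
def act (T : Turing.Tape M.Symbol) (a : M.Symbol × Option Turing.Dir) : Turing.Tape M.Symbol :=
  match a.2 with
  | none => T.write a.1
  | some d => (T.write a.1).move d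

/-- One step of the machine; a halted configuration does not change any more. -/
def step (c : M.Cfg) : M.Cfg :=
  match c.status with
  | Sum.inr _ => c
  | Sum.inl q =>
    let r := M.δ q fun i => (c.tape i).head
    { status := r.1, tape := fun i => M.act (c.tape i) (r.2 i) }

/-- The configuration after `t` steps on the input `w`. -/
def run (w : List X) (t : ℕ) : M.Cfg := M.step^[t] (M.init w)

/-- On the input `w` the machine has halted with the verdict `b` after at most `t` steps. -/
def HaltsWith (w : List X) (b : Bool) (t : ℕ) : Prop := (M.run w t).status = Sum.inr b

/-- The running time on the input `w`: the number of steps until the machine halts, and `⊤` if it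
never halts. -/
noncomputable def time (w : List X) : ℕ∞ :=
  ⨅ (t : ℕ) (_ : ∃ b, M.HaltsWith w b t), (t : ℕ∞)

/-- The machine halts on every word, accepting the words of `L` and rejecting all others. -/
def Decides (L : Language X) : Prop :=
  ∀ w : List X, (w ∈ L → ∃ t, M.HaltsWith w true t) ∧ (w ∉ L → ∃ t, M.HaltsWith w false t)

end MultiTapeTM

/-! ### Complexity classes -/

/-- A class of languages: a set of languages over each alphabet. -/
abbrev LanguageClass := ∀ X : Type, Set (Language X)

/-- The constraint families of time-complexity classes: families of non-decreasing functions
`f n ≥ n`, closed under `f ↦ C * f (C * n + C) + C` for all integers `C ≥ 1`. -/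
structure IsTimeFamily (𝓕 : Set (ℕ → ℕ)) : Prop where
  monotone : ∀ f ∈ 𝓕, Monotone f
  le_self : ∀ f ∈ 𝓕, ∀ n, n ≤ f n
  closed : ∀ f ∈ 𝓕, ∀ C : ℕ, 1 ≤ C → (fun n => C * f (C * n + C) + C) ∈ 𝓕

/-- The languages decidable in time bounded by a member of `𝓕`. -/
def DTime (𝓕 : Set (ℕ → ℕ)) : LanguageClass := fun X =>
  {L | ∃ f ∈ 𝓕, ∃ M : MultiTapeTM X, M.Decides L ∧ ∀ w, M.time w ≤ (f w.length : ℕ∞)}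

/-- `f` is subexponential: `f n / r ^ n → 0` for every `r > 1`. -/
def IsSubexponential (f : ℕ → ℝ≥0) : Prop :=
  ∀ r : ℝ, 1 < r → Filter.Tendsto (fun n => (f n : ℝ) / r ^ n) Filter.atTop (nhds 0)

/-- The languages decidable in deterministic subexponential time. -/
def SubExp : LanguageClass := fun X =>
  {L | ∃ f : ℕ → ℝ≥0, IsSubexponential f ∧
    ∃ M : MultiTapeTM X, M.Decides L ∧ ∀ w, (M.time w : ℝ≥0∞) ≤ (f w.length : ℝ≥0∞)}

/-! ### Groups -/

/-- The letters of the family `π`, which may repeat elements, generate `G`. -/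
def IsGeneratingFamily {A G : Type*} [Group G] (π : A → G) : Prop :=
  Subgroup.closure (Set.range π) = ⊤

/-- The word problem of `G` relative to `π : A → G`: all words in the letters of `A` and their
formal inverses, `(a, true)` standing for `a` and `(a, false)` for the inverse of `a`, which
represent the identity. -/
def wordProblem {A G : Type*} [Group G] (π : A → G) : Language (A × Bool) :=
  {w | FreeGroup.lift π (FreeGroup.mk w) = 1}

/-- `G` has a finite generating family relative to which its word problem belongs to `𝒞`. -/
def HasWordProblemIn (G : Type*) [Group G] (𝒞 : LanguageClass) : Prop :=
  ∃ (n : ℕ) (π : Fin n → G), IsGeneratingFamily π ∧ wordProblem π ∈ 𝒞 (Fin n × Bool)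

open Classical in
/-- Amenability of a discrete group, as the Følner condition: for every finite set `S` of elements
and every `ε > 0` there is a finite non-empty set `F` that every right translation by an element of
`S` moves by at most the proportion `ε`. -/
def IsAmenableGroup (G : Type*) [Group G] : Prop :=
  ∀ (S : Finset G) (ε : ℝ), 0 < ε → ∃ F : Finset G, F.Nonempty ∧
    ∀ s ∈ S, (((F.image (· * s)) ∆ F).card : ℝ) ≤ ε * (F.card : ℝ)

/-! ### Average-case complexity with inputs from a free group -/

/-- A discrete probability measure on the free group is length-invariant if elements with equally
long reduced words have the same probability. -/
def IsLengthInvariant {A : Type*} [DecidableEq A] (μ : PMF (FreeGroup A)) : Prop :=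
  ∀ u v : FreeGroup A, u.norm = v.norm → μ u = μ v

/-- The machine `M` solves `L` with average-case time-complexity bounded by the positive
non-decreasing function `f`, uniformly relative to the family `R` of discrete probability measures
on the free group, whose elements are given to `M` as reduced words. -/
def MultiTapeTM.SolvesOnAverage {A : Type*} [DecidableEq A] (M : MultiTapeTM (A × Bool))
    (L : Language (A × Bool)) (f : ℕ → ℕ) (R : Set (PMF (FreeGroup A))) : Prop :=
  M.Decides L ∧ Monotone f ∧ (∀ n, 0 < f n) ∧
    ∃ K : ℝ≥0, 0 < K ∧ ∀ μ ∈ R,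
      ∑' v : FreeGroup A, (M.time v.toWord : ℝ≥0∞) / (f v.norm : ℝ≥0∞) * μ v ≤ (K : ℝ≥0∞)

/-!
Let `N` be the kernel of `φ`, as a subgroup of `G`. Since `Q` is not amenable, it has a bounded
doubling (a form of paradoxicality), and so has the action of `G` on `G ⧸ N`. Hence the averaging
operator of a generating family of `G` on `ℓ²(G ⧸ N)` has norm less than one, so there is a
positive function on `G ⧸ N` which the averaging operator shrinks by a constant factor. Comparing
reduced words with such a function shows that the proportion of the reduced words of length `n`
which represent elements of `N` decays exponentially in `n`.

A machine can therefore first rewrite its input along the cosets of `H` and test membership in `N`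
by means of the fast algorithm for `Q`, and resort to the subexponential algorithm for `G` only on
the words which pass the test. On every sphere the rarity of these words outweighs the cost of
treating them, and a length-invariant measure is a mixture of the uniform measures on spheres.
-/

/-! ### Bounded doublings -/

/-- The space `X` with an action of `G` can be injected twice into itself, with disjoint images, by
maps which move every point by an element of a fixed finite subset of `G`. The two copies of `X`
are indexed by `Bool`. For the translation action of a group this is paradoxicality. -/
def HasBoundedDoubling (G X : Type*) [SMul G X] : Prop :=
  ∃ (T : Finset G) (ι : X × Bool → X), Function.Injective ι ∧ ∀ p, ∃ t ∈ T, ι p = t • p.1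

section Doubling

open scoped Pointwise

theorem card_symmDiff_eq_two_mul_card_sdiff {α : Type*} [DecidableEq α] {s t : Finset α}
    (h : s.card = t.card) : (s ∆ t).card = 2 * (s \ t).card := by
  have hunion : (s ∆ t).card = (s \ t).card + (t \ s).card :=
    Finset.card_union_of_disjoint disjoint_sdiff_sdiff
  rw [hunion, Finset.card_sdiff_comm h, two_mul]

open Classical in
theorem exists_mul_card_le_card_mul {Q : Type*} [Group Q] (hQ : ¬ IsAmenableGroup Q) :
    ∃ (T : Finset Q) (r : ℝ), 1 < r ∧ ∀ F : Finset Q, r * F.card ≤ ((F * T).card : ℝ) := by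
  simp only [IsAmenableGroup, not_forall, not_exists, not_and, not_le] at hQ
  obtain ⟨S, ε, hε, hS⟩ := hQ
  refine ⟨insert 1 S, 1 + ε / 2, by linarith, fun F => ?_⟩
  rcases F.eq_empty_or_nonempty with rfl | hF
  · simp
  obtain ⟨s, hs, hlt⟩ := hS F hF
  rw [card_symmDiff_eq_two_mul_card_sdiff
    (Finset.card_image_of_injective F (mul_left_injective s))] at hlt
  have hsub : F ∪ (F.image (· * s) \ F) ⊆ F * insert 1 S := by
    rw [Finset.union_sdiff_self_eq_union]
    refine Finset.union_subset (fun x hx => ?_) (Finset.image_subset_iff.2 fun x hx => ?_)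
    · simpa using Finset.mul_mem_mul hx (Finset.mem_insert_self 1 S)
    · exact Finset.mul_mem_mul hx (Finset.mem_insert_of_mem hs)
  have hcard := Finset.card_le_card hsub
  rw [Finset.card_union_of_disjoint Finset.disjoint_sdiff] at hcard
  have hcard' : (F.card + (F.image (· * s) \ F).card : ℝ) ≤ (F * insert 1 S).card := by
    exact_mod_cast hcard
  push_cast at hlt
  linarith

theorem exists_pow_mul_card_le_card_mul {Q : Type*} [Group Q] [DecidableEq Q] {T : Finset Q}
    {r : ℝ} (hr : 0 ≤ r) (hT : ∀ F : Finset Q, r * F.card ≤ ((F * T).card : ℝ)) (n : ℕ)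
    (F : Finset Q) : r ^ n * F.card ≤ ((F * T ^ n).card : ℝ) := by
  induction n with
  | zero => simp
  | succ n ih =>
    calc r ^ (n + 1) * F.card = r * (r ^ n * F.card) := by ring
      _ ≤ r * ((F * T ^ n).card : ℝ) := by gcongr
      _ ≤ (F * T ^ n * T).card := hT _
      _ = (F * T ^ (n + 1)).card := by rw [pow_succ, mul_assoc]

theorem hasBoundedDoubling_of_two_mul_card_le {G X : Type*} [SMul G X] [DecidableEq X]
    {T : Finset G} (hT : ∀ F : Finset X, 2 * F.card ≤ (T • F).card) :
    HasBoundedDoubling G X := by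
  have hHall : ∀ s : Finset (X × Bool), s.card ≤ (s.biUnion fun p => T.image (· • p.1)).card := by
    intro s
    calc s.card ≤ (s.image Prod.fst ×ˢ (Finset.univ : Finset Bool)).card :=
          Finset.card_le_card fun p hp =>
            Finset.mem_product.2 ⟨Finset.mem_image_of_mem _ hp, Finset.mem_univ _⟩
      _ = 2 * (s.image Prod.fst).card := by
          rw [Finset.card_product, Finset.card_univ, Fintype.card_bool, mul_comm]
      _ ≤ (T • s.image Prod.fst).card := hT _
      _ ≤ (s.biUnion fun p => T.image (· • p.1)).card := by
          refine Finset.card_le_card (Finset.smul_subset_iff.2 fun t ht x hx => ?_)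
          obtain ⟨p, hp, rfl⟩ := Finset.mem_image.1 hx
          exact Finset.mem_biUnion.2 ⟨p, hp, Finset.mem_image_of_mem _ ht⟩
  obtain ⟨ι, hι, hmem⟩ := (Finset.all_card_le_biUnion_card_iff_exists_injective _).1 hHall
  refine ⟨T, ι, hι, fun p => ?_⟩
  obtain ⟨t, ht, h⟩ := Finset.mem_image.1 (hmem p)
  exact ⟨t, ht, h.symm⟩

theorem hasBoundedDoubling_of_not_isAmenableGroup {Q : Type*} [Group Q]
    (hQ : ¬ IsAmenableGroup Q) : HasBoundedDoubling Q Q := by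
  classical
  obtain ⟨T, r, hr, hT⟩ := exists_mul_card_le_card_mul hQ
  obtain ⟨n, hn⟩ := pow_unbounded_of_one_lt 2 hr
  refine hasBoundedDoubling_of_two_mul_card_le (T := (T ^ n)⁻¹) fun F => ?_
  have hF : (2 * F⁻¹.card : ℝ) ≤ (F⁻¹ * T ^ n).card :=
    (by gcongr : (2 * F⁻¹.card : ℝ) ≤ r ^ n * F⁻¹.card).trans
      (exists_pow_mul_card_le_card_mul (by positivity) hT n F⁻¹)
  rw [← Finset.card_inv (F⁻¹ * T ^ n), mul_inv_rev, inv_inv, Finset.card_inv] at hF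
  exact_mod_cast hF

theorem HasBoundedDoubling.of_bijective {G H X Y I : Type*} [SMul G X] [SMul H Y] [Finite I]
    (hY : HasBoundedDoubling H Y) {e : I × Y → X} (he : Function.Bijective e)
    (hsmul : ∀ i (h : H), ∃ g : G, ∀ y, g • e (i, y) = e (i, h • y)) :
    HasBoundedDoubling G X := by
  classical
  have := Fintype.ofFinite I
  obtain ⟨T, ι, hι, hT⟩ := hY
  obtain ⟨e, rfl⟩ : ∃ e' : I × Y ≃ X, e' = e := ⟨Equiv.ofBijective e he, rfl⟩
  choose g hg using hsmul
  refine ⟨Finset.image₂ g Finset.univ T,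
    fun p => e ((e.symm p.1).1, ι ((e.symm p.1).2, p.2)), ?_, ?_⟩
  · rintro ⟨x, b⟩ ⟨x', b'⟩ h
    obtain ⟨hi, hιeq⟩ := Prod.mk.inj (e.injective h)
    obtain ⟨hy, hb⟩ := Prod.mk.inj (hι hιeq)
    exact Prod.ext (e.symm.injective (Prod.ext hi hy)) hb
  · rintro ⟨x, b⟩
    obtain ⟨⟨i, y⟩, rfl⟩ := e.surjective x
    obtain ⟨t, ht, h⟩ := hT (y, b)
    refine ⟨g i t, Finset.mem_image₂_of_mem (Finset.mem_univ i) ht, ?_⟩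
    simp only [Equiv.symm_apply_apply, h, hg]

end Doubling

section VirtualQuotient

variable {G Q : Type*} [Group G] [Group Q] {H : Subgroup G} {φ : H →* Q}

theorem coe_mem_map_subtype_ker {h : H} : (h : G) ∈ φ.ker.map H.subtype ↔ φ h = 1 :=
  (Subgroup.mem_map_iff_mem H.subtype_injective).trans MonoidHom.mem_ker

theorem bijective_mk_out_mul {s : Q → H} (hs : ∀ q, φ (s q) = q) :
    Function.Bijective fun p : (G ⧸ H) × Q =>
      ((p.1.out * s p.2 : G) : G ⧸ φ.ker.map H.subtype) := by
  constructor
  · rintro ⟨i, q⟩ ⟨j, q'⟩ h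
    have hmem : (i.out * s q : G)⁻¹ * (j.out * s q') ∈ φ.ker.map H.subtype := QuotientGroup.eq.1 h
    obtain rfl : i = j := by
      have hH := Subgroup.map_subtype_le _ hmem
      rw [← QuotientGroup.eq, QuotientGroup.mk_mul_of_mem _ (s q).2,
        QuotientGroup.mk_mul_of_mem _ (s q').2] at hH
      simpa only [QuotientGroup.out_eq'] using hH
    have hker : φ ((s q)⁻¹ * s q') = 1 := by
      rw [← coe_mem_map_subtype_ker]
      simpa [mul_assoc] using hmem
    rw [map_mul, map_inv, hs, hs, inv_mul_eq_one] at hker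
    rw [hker]
  · intro x
    obtain ⟨g, rfl⟩ := QuotientGroup.mk_surjective x
    obtain ⟨h, hh⟩ : ∃ h : H, (h : G) = (g : G ⧸ H).out⁻¹ * g :=
      ⟨⟨_, QuotientGroup.eq.1 (QuotientGroup.out_eq' _)⟩, rfl⟩
    refine ⟨((g : G ⧸ H), φ h), QuotientGroup.eq.2 ?_⟩
    have hmem : (((s (φ h))⁻¹ * h : H) : G) ∈ φ.ker.map H.subtype :=
      coe_mem_map_subtype_ker.2 (by rw [map_mul, map_inv, hs, inv_mul_cancel])
    simpa [hh, mul_assoc] using hmem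

/-- On the translates of `H ⧸ φ.ker`, which is `Q`, conjugates of elements of `H` act as `Q`. -/
theorem hasBoundedDoubling_quotient_map_ker [H.FiniteIndex] (hφ : Function.Surjective φ)
    (hQ : HasBoundedDoubling Q Q) : HasBoundedDoubling G (G ⧸ φ.ker.map H.subtype) := by
  choose s hs using hφ
  refine hQ.of_bijective (bijective_mk_out_mul hs) fun i t =>
    ⟨i.out * s t * i.out⁻¹, fun q => QuotientGroup.eq.2 ?_⟩
  have hmem : (((s t * s q)⁻¹ * s (t * q) : H) : G) ∈ φ.ker.map H.subtype :=
    coe_mem_map_subtype_ker.2 (by simp only [map_mul, map_inv, hs, inv_mul_cancel])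
  simpa [mul_assoc] using hmem

end VirtualQuotient

/-! ### Square-summable functions on a `G`-space -/

/-- The Hilbert space of square-summable real functions on the discrete space `X`. -/
abbrev EllTwo (X : Type*) : Type _ := lp (fun _ : X => ℝ) 2

theorem mul_negPart_self (a : ℝ) : a * a⁻ = -a⁻ ^ 2 := by
  rcases le_total 0 a with ha | ha
  · simp [negPart_of_nonneg ha]
  · simp [negPart_of_nonpos ha, sq]

theorem sub_mul_negPart_sub_negPart_le (a b : ℝ) : (a - b) * (a⁻ - b⁻) ≤ -(a⁻ - b⁻) ^ 2 := by
  have ha := mul_negPart_self a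
  have hb := mul_negPart_self b
  have hab : 0 ≤ (a + a⁻) * b⁻ :=
    mul_nonneg (neg_le_iff_add_nonneg'.1 (neg_le_negPart a)) (negPart_nonneg b)
  have hba : 0 ≤ (b + b⁻) * a⁻ :=
    mul_nonneg (neg_le_iff_add_nonneg'.1 (neg_le_negPart b)) (negPart_nonneg a)
  linarith

namespace EllTwo

variable {X : Type*}

theorem hasSum_sq (f : EllTwo X) : HasSum (fun x => f x ^ 2) (‖f‖ ^ 2) := by
  simpa using lp.hasSum_norm (p := 2) (by norm_num) f

theorem hasSum_mul (f g : EllTwo X) : HasSum (fun x => f x * g x) (inner ℝ f g) := by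
  simpa [mul_comm] using lp.hasSum_inner (𝕜 := ℝ) f g

/-- The pointwise negative part `max (-f) 0`. -/
noncomputable def negPart (f : EllTwo X) : EllTwo X :=
  ⟨fun x => (f x)⁻, (lp.memℓp f).mono' fun x => by
    rw [Real.norm_of_nonneg (negPart_nonneg _), Real.norm_eq_abs, ← posPart_add_negPart]
    exact le_add_of_nonneg_left (posPart_nonneg _)⟩

theorem negPart_apply (f : EllTwo X) (x : X) : f.negPart x = (f x)⁻ := rfl

theorem inner_negPart (f : EllTwo X) : inner ℝ f f.negPart = -‖f.negPart‖ ^ 2 := by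
  refine (hasSum_mul f f.negPart).unique ?_
  simpa only [negPart_apply, mul_negPart_self] using (hasSum_sq f.negPart).neg

variable {G : Type*} [Group G] [MulAction G X]

theorem hasSum_smul_sq (g : G) (f : EllTwo X) : HasSum (fun x => f (g • x) ^ 2) (‖f‖ ^ 2) :=
  (MulAction.toPerm g).hasSum_iff (f := fun x => f x ^ 2) |>.2 (hasSum_sq f)

theorem memℓp_smul (g : G) (f : EllTwo X) : Memℓp (fun x => f (g • x)) 2 :=
  memℓp_gen (by simpa using (hasSum_smul_sq g f).summable)

variable (X) in
/-- The unitary operator of translation by `g`. -/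
noncomputable def koopman (g : G) : EllTwo X →ₗᵢ[ℝ] EllTwo X where
  toFun f := ⟨fun x => f (g • x), memℓp_smul g f⟩
  map_add' _ _ := rfl
  map_smul' _ _ := rfl
  norm_map' f := by
    rw [← sq_eq_sq₀ (norm_nonneg _) (norm_nonneg _)]
    exact HasSum.unique (hasSum_sq ⟨fun x => f (g • x), memℓp_smul g f⟩) (hasSum_smul_sq g f)

theorem koopman_apply (g : G) (f : EllTwo X) (x : X) : koopman X g f x = f (g • x) := rfl

theorem koopman_one (f : EllTwo X) : koopman X (1 : G) f = f := by
  ext x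
  rw [koopman_apply, one_smul]

theorem koopman_mul (g h : G) (f : EllTwo X) :
    koopman X (g * h) f = koopman X h (koopman X g f) := by
  ext x
  simp only [koopman_apply, mul_smul]

theorem koopman_inv_koopman (g : G) (f : EllTwo X) : koopman X g⁻¹ (koopman X g f) = f := by
  rw [← koopman_mul, mul_inv_cancel, koopman_one]

theorem inner_koopman_inv_left (g : G) (f f' : EllTwo X) :
    inner ℝ (koopman X g⁻¹ f) f' = inner ℝ f (koopman X g f') := by
  rw [← (koopman X g⁻¹).inner_map_map f, koopman_inv_koopman]

theorem inner_koopman_sub_negPart_le (g : G) (f : EllTwo X) :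
    inner ℝ (koopman X g f - f) (koopman X g f.negPart - f.negPart)
      ≤ -‖koopman X g f.negPart - f.negPart‖ ^ 2 :=
  hasSum_le (fun x => sub_mul_negPart_sub_negPart_le (f (g • x)) (f x))
    (hasSum_mul (koopman X g f - f) _) (hasSum_sq (koopman X g f.negPart - f.negPart)).neg

/-! ### The spectral gap of a space with a bounded doubling -/

theorem hasSum_prod_bool_fst {g : X → ℝ} {c : ℝ} (hg : HasSum g c) :
    HasSum (fun p : X × Bool => g p.1) (c + c) := by
  rw [← (Equiv.boolProdEquivSum X).symm.trans (Equiv.prodComm Bool X) |>.hasSum_iff]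
  exact HasSum.sum hg hg

theorem norm_sq_le_sum_norm_koopman_sub_sq {T : Finset G} {ι : X × Bool → X}
    (hι : Function.Injective ι) (hT : ∀ p, ∃ t ∈ T, ι p = t • p.1) (f : EllTwo X) :
    ‖f‖ ^ 2 ≤ 12 * ∑ t ∈ T, ‖koopman X t f - f‖ ^ 2 := by
  have hpointwise : ∀ p : X × Bool, f p.1 ^ 2
      ≤ 3 / 2 * f (ι p) ^ 2 + 3 * ∑ t ∈ T, (koopman X t f - f) p.1 ^ 2 := by
    intro p
    obtain ⟨t, ht, h⟩ := hT p
    have hle : (f (t • p.1) - f p.1) ^ 2 ≤ ∑ t ∈ T, (koopman X t f - f) p.1 ^ 2 :=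
      Finset.single_le_sum (f := fun t => (koopman X t f - f) p.1 ^ 2)
        (fun _ _ => sq_nonneg _) ht
    rw [h]
    linarith [sq_nonneg (3 * f (t • p.1) - 2 * f p.1)]
  have hιsum : Summable fun p => f (ι p) ^ 2 := (hasSum_sq f).summable.comp_injective hι
  have hιle : ∑' p, f (ι p) ^ 2 ≤ ‖f‖ ^ 2 := by
    rw [← (hasSum_sq f).tsum_eq]
    exact tsum_comp_le_tsum_of_inj (hasSum_sq f).summable (fun _ => sq_nonneg _) hι
  have hsum := hasSum_le hpointwise (hasSum_prod_bool_fst (hasSum_sq f))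
    ((hιsum.hasSum.mul_left _).add ((hasSum_prod_bool_fst
      (hasSum_sum fun t _ => hasSum_sq (koopman X t f - f))).mul_left 3))
  linarith

variable {A : Type*} [Fintype A]

variable (X) in
/-- The combinatorial Laplacian of the graph on `X` whose edges join `x` to `γ a • x`. -/
noncomputable def laplacian (γ : A → G) : EllTwo X →L[ℝ] EllTwo X :=
  ∑ a, (2 • ContinuousLinearMap.id ℝ (EllTwo X) - (koopman X (γ a)).toContinuousLinearMap
    - (koopman X (γ a)⁻¹).toContinuousLinearMap)

theorem laplacian_apply (γ : A → G) (f : EllTwo X) :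
    laplacian X γ f = ∑ a, (2 • f - koopman X (γ a) f - koopman X (γ a)⁻¹ f) := by
  simp [laplacian]

theorem laplacian_apply_apply (γ : A → G) (f : EllTwo X) (x : X) :
    laplacian X γ f x
      = 2 * Fintype.card A * f x - ∑ a, (f (γ a • x) + f ((γ a)⁻¹ • x)) := by
  have hterm : ∀ a, (2 • f - koopman X (γ a) f - koopman X (γ a)⁻¹ f) x
      = 2 * f x - (f (γ a • x) + f ((γ a)⁻¹ • x)) := fun a => by
    rw [two_smul, two_mul, ← sub_sub]
    rfl
  rw [laplacian_apply, lp.coeFn_sum, Finset.sum_apply, Finset.sum_congr rfl fun a _ => hterm a,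
    Finset.sum_sub_distrib, Finset.sum_const, Finset.card_univ, nsmul_eq_mul]
  ring

theorem inner_laplacian (γ : A → G) (f f' : EllTwo X) : inner ℝ (laplacian X γ f) f'
    = ∑ a, inner ℝ (koopman X (γ a) f - f) (koopman X (γ a) f' - f') := by
  rw [laplacian_apply, sum_inner]
  refine Finset.sum_congr rfl fun a _ => ?_
  simp only [inner_sub_left, inner_sub_right, inner_koopman_inv_left, two_smul, inner_add_left,
    LinearIsometry.inner_map_map]
  ring

theorem inner_laplacian_self (γ : A → G) (f : EllTwo X) :
    inner ℝ (laplacian X γ f) f = ∑ a, ‖koopman X (γ a) f - f‖ ^ 2 := by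
  simp only [inner_laplacian, real_inner_self_eq_norm_sq]

theorem inner_laplacian_self_nonneg (γ : A → G) (f : EllTwo X) :
    0 ≤ inner ℝ (laplacian X γ f) f := by
  rw [inner_laplacian_self]
  positivity

theorem exists_norm_koopman_sub_sq_le {γ : A → G} (hγ : IsGeneratingFamily γ) (g : G) :
    ∃ C : ℝ, 0 ≤ C ∧ ∀ f : EllTwo X,
      ‖koopman X g f - f‖ ^ 2 ≤ C * inner ℝ (laplacian X γ f) f := by
  have hg : g ∈ Subgroup.closure (Set.range γ) := hγ ▸ Subgroup.mem_top g
  induction hg using Subgroup.closure_induction with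
  | mem g hg =>
    obtain ⟨a, rfl⟩ := hg
    refine ⟨1, zero_le_one, fun f => ?_⟩
    rw [one_mul, inner_laplacian_self]
    exact Finset.single_le_sum (f := fun a => ‖koopman X (γ a) f - f‖ ^ 2)
      (fun _ _ => sq_nonneg _) (Finset.mem_univ a)
  | one => exact ⟨0, le_rfl, fun f => by simp [koopman_one]⟩
  | mul g h _ _ hg hh =>
    obtain ⟨C, hC, hg⟩ := hg
    obtain ⟨C', hC', hh⟩ := hh
    refine ⟨2 * (C + C'), by positivity, fun f => ?_⟩
    have hsub : koopman X (g * h) f - f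
        = koopman X h (koopman X g f - f) + (koopman X h f - f) := by
      rw [koopman_mul, map_sub, sub_add_sub_cancel]
    calc ‖koopman X (g * h) f - f‖ ^ 2
        ≤ (‖koopman X g f - f‖ + ‖koopman X h f - f‖) ^ 2 := by
          rw [hsub, ← (koopman X h).norm_map (koopman X g f - f)]
          gcongr
          exact norm_add_le _ _
      _ ≤ 2 * (‖koopman X g f - f‖ ^ 2 + ‖koopman X h f - f‖ ^ 2) := add_sq_le
      _ ≤ 2 * (C + C') * inner ℝ (laplacian X γ f) f := by linarith [hg f, hh f]
  | inv g _ hg =>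
    obtain ⟨C, hC, hg⟩ := hg
    refine ⟨C, hC, fun f => ?_⟩
    rw [← (koopman X g).norm_map, map_sub, ← koopman_mul, inv_mul_cancel, koopman_one,
      norm_sub_rev]
    exact hg f

theorem exists_mul_norm_sq_le_inner_laplacian {γ : A → G} (hγ : IsGeneratingFamily γ)
    (hX : HasBoundedDoubling G X) : ∃ κ : ℝ≥0, 0 < κ ∧ ∀ f : EllTwo X,
      κ * ‖f‖ ^ 2 ≤ inner ℝ (laplacian X γ f) f := by
  obtain ⟨T, ι, hι, hT⟩ := hX
  choose C hC hCle using exists_norm_koopman_sub_sq_le (X := X) hγ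
  have hpos : 0 < 12 * ∑ t ∈ T, C t + 1 := by
    have := Finset.sum_nonneg fun t (_ : t ∈ T) => hC t
    positivity
  refine ⟨⟨(12 * ∑ t ∈ T, C t + 1)⁻¹, inv_nonneg.2 hpos.le⟩, inv_pos.2 hpos, fun f => ?_⟩
  refine (inv_mul_le_iff₀ hpos).2 ?_
  calc ‖f‖ ^ 2 ≤ 12 * ∑ t ∈ T, ‖koopman X t f - f‖ ^ 2 :=
        norm_sq_le_sum_norm_koopman_sub_sq hι hT f
    _ ≤ 12 * ∑ t ∈ T, C t * inner ℝ (laplacian X γ f) f := by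
        gcongr with t
        exact hCle t f
    _ ≤ (12 * ∑ t ∈ T, C t + 1) * inner ℝ (laplacian X γ f) f := by
        rw [← Finset.sum_mul]
        linarith [inner_laplacian_self_nonneg γ f]

/-! ### Positive supersolutions -/

theorem exists_laplacian_sub_smul_eq {γ : A → G} {κ c : ℝ≥0} (hc : c < κ)
    (hκ : ∀ f : EllTwo X, κ * ‖f‖ ^ 2 ≤ inner ℝ (laplacian X γ f) f) (δ : EllTwo X) :
    ∃ u : EllTwo X, laplacian X γ u - (c : ℝ) • u = δ := by
  have hunit : IsUnit (laplacian X γ - (c : ℝ) • ContinuousLinearMap.id ℝ (EllTwo X)) := by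
    refine ContinuousLinearMap.isUnit_of_forall_le_norm_inner_map (𝕜 := ℝ) _ (c := κ - c)
      (tsub_pos_of_lt hc) fun f => le_trans ?_ (Real.le_norm_self _)
    simp only [sub_apply, smul_apply, ContinuousLinearMap.id_apply, inner_sub_left,
      real_inner_smul_left, real_inner_self_eq_norm_sq, NNReal.coe_sub hc.le]
    linarith [hκ f]
  exact (ContinuousLinearMap.isUnit_iff_bijective.1 hunit).surjective δ

/-- The maximum principle, obtained by testing the equation against the negative part of `u`. -/
theorem nonneg_of_laplacian_sub_smul_nonneg {γ : A → G} {κ c : ℝ} (hc : c < κ)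
    (hκ : ∀ f : EllTwo X, κ * ‖f‖ ^ 2 ≤ inner ℝ (laplacian X γ f) f) {u : EllTwo X}
    (hu : ∀ x, 0 ≤ (laplacian X γ u - c • u) x) (x : X) : 0 ≤ u x := by
  have hlaplacian : inner ℝ (laplacian X γ u) u.negPart
      ≤ -inner ℝ (laplacian X γ u.negPart) u.negPart := by
    rw [inner_laplacian, inner_laplacian_self, ← Finset.sum_neg_distrib]
    exact Finset.sum_le_sum fun a _ => inner_koopman_sub_negPart_le (γ a) u
  have htest : 0 ≤ inner ℝ (laplacian X γ u - c • u) u.negPart :=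
    (hasSum_mul _ _).nonneg fun x => mul_nonneg (hu x) (negPart_nonneg (u x))
  rw [inner_sub_left, real_inner_smul_left, inner_negPart] at htest
  have hnorm : ‖u.negPart‖ ^ 2 = 0 := by nlinarith [hκ u.negPart, sq_nonneg ‖u.negPart‖]
  have hzero : u.negPart = 0 := norm_eq_zero.1 (pow_eq_zero_iff two_ne_zero |>.1 hnorm)
  rw [← negPart_eq_zero, ← negPart_apply, hzero, lp.coeFn_zero, Pi.zero_apply]

end EllTwo

section Supersolution

variable {G X A : Type*} [Group G] [MulAction G X] [MulAction.IsPretransitive G X] [Fintype A]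

open scoped Pointwise in
theorem pos_of_sum_add_le {γ : A → G} (hγ : IsGeneratingFamily γ) {u : X → ℝ} {l : ℝ}
    (hu : ∀ x, 0 ≤ u x) (hle : ∀ x, ∑ a, (u (γ a • x) + u ((γ a)⁻¹ • x)) ≤ l * u x) {x₀ : X}
    (hx₀ : u x₀ ≠ 0) (x : X) : 0 < u x := by
  have hnbr : ∀ x a, u x = 0 → u (γ a • x) = 0 ∧ u ((γ a)⁻¹ • x) = 0 := fun x a hx => by
    have hsingle := Finset.single_le_sum (f := fun a => u (γ a • x) + u ((γ a)⁻¹ • x))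
      (fun a _ => add_nonneg (hu _) (hu _)) (Finset.mem_univ a)
    have hx' := hle x
    rw [hx, mul_zero] at hx'
    exact (add_eq_zero_iff_of_nonneg (hu _) (hu _)).1
      ((hsingle.trans hx').antisymm (add_nonneg (hu _) (hu _)))
  have hstabilizer : MulAction.stabilizer G {x | u x = 0} = ⊤ := by
    rw [eq_top_iff, ← hγ, Subgroup.closure_le]
    rintro _ ⟨a, rfl⟩
    refine MulAction.mem_stabilizer_set.2 fun x => ⟨fun hx => ?_, fun hx => (hnbr x a hx).1⟩
    simpa using (hnbr _ a hx).2
  refine (hu x).lt_of_ne' fun hx => hx₀ ?_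
  obtain ⟨g, rfl⟩ := MulAction.exists_smul_eq G x x₀
  exact (MulAction.mem_stabilizer_set.1 (hstabilizer ▸ Subgroup.mem_top g) x).2 hx

theorem exists_pos_supersolution [Nonempty X] {γ : A → G} (hγ : IsGeneratingFamily γ)
    (hX : HasBoundedDoubling G X) :
    ∃ (u : X → ℝ) (l : ℝ), l < 2 * Fintype.card A ∧ (∀ x, 0 < u x) ∧
      ∀ x, ∑ a, (u (γ a • x) + u ((γ a)⁻¹ • x)) ≤ l * u x := by
  classical
  obtain ⟨x₀⟩ := ‹Nonempty X›
  obtain ⟨κ, hκ, hgap⟩ := EllTwo.exists_mul_norm_sq_le_inner_laplacian hγ hX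
  obtain ⟨u, hu⟩ :=
    EllTwo.exists_laplacian_sub_smul_eq (half_lt_self hκ) hgap (lp.single 2 x₀ 1)
  have hδ : ∀ x, 0 ≤ (lp.single 2 x₀ 1 : EllTwo X) x := fun x => by
    rw [lp.single_apply, Pi.single_apply]
    positivity
  have hnonneg : ∀ x, 0 ≤ u x :=
    EllTwo.nonneg_of_laplacian_sub_smul_nonneg (NNReal.coe_lt_coe.2 (half_lt_self hκ)) hgap
      fun x => hu ▸ hδ x
  have hle : ∀ x, ∑ a, (u (γ a • x) + u ((γ a)⁻¹ • x))
      ≤ (2 * Fintype.card A - (κ / 2 : ℝ≥0)) * u x := fun x => by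
    have hx := hδ x
    rw [← hu, lp.coeFn_sub, Pi.sub_apply, lp.coeFn_smul, Pi.smul_apply,
      EllTwo.laplacian_apply_apply, smul_eq_mul] at hx
    linarith
  obtain ⟨x₁, hx₁⟩ : ∃ x, u x ≠ 0 := by
    by_contra! h
    have hzero : u = 0 := lp.ext (funext h)
    have := congrArg (fun f : EllTwo X => f x₀) hu
    simp [hzero] at this
  refine ⟨u, _, sub_lt_self _ (by positivity), pos_of_sum_add_le hγ hnonneg hle hx₁, hle⟩

end Supersolution

/-! ### Cones and spheres in free groups -/

/-- The generator or inverse generator of the free group named by a letter `s`, which is `s.1` for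
`s.2 = true` and its inverse for `s.2 = false`. -/
def signedLetter {A : Type*} (s : A × Bool) : FreeGroup A := FreeGroup.mk [s]

section Sphere

variable {A : Type*}

theorem signedLetter_not (s : A × Bool) : signedLetter (s.1, !s.2) = (signedLetter s)⁻¹ := rfl

theorem mk_cons (s : A × Bool) (w : List (A × Bool)) :
    FreeGroup.mk (s :: w) = signedLetter s * FreeGroup.mk w := rfl

theorem isReduced_cons_cons_iff {s s' : A × Bool} {w : List (A × Bool)} :
    FreeGroup.IsReduced (s :: s' :: w) ↔ s' ≠ (s.1, !s.2) ∧ FreeGroup.IsReduced (s' :: w) := by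
  rw [FreeGroup.isReduced_cons_cons]
  refine and_congr_left fun _ => ?_
  obtain ⟨a, b⟩ := s
  obtain ⟨a', b'⟩ := s'
  cases b <;> cases b' <;> simp [eq_comm]

variable [DecidableEq A]

theorem toWord_signedLetter_mul {s : A × Bool} {v : FreeGroup A}
    (h : FreeGroup.IsReduced (s :: v.toWord)) : (signedLetter s * v).toWord = s :: v.toWord := by
  rw [← h.reduce_eq, ← FreeGroup.toWord_mk, mk_cons, FreeGroup.mk_toWord]

variable [Fintype A]

/-- The elements of length `n + 1` of the free group whose reduced word begins with `s`. -/
def cone : ℕ → A × Bool → Finset (FreeGroup A)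
  | 0, s => {signedLetter s}
  | n + 1, s => (Finset.univ.erase (s.1, !s.2)).biUnion fun s' =>
      (cone n s').image (signedLetter s * ·)

theorem mem_cone {n : ℕ} {s : A × Bool} {v : FreeGroup A} :
    v ∈ cone n s ↔ ∃ w, v.toWord = s :: w ∧ w.length = n := by
  induction n generalizing s v with
  | zero =>
    have hs : (signedLetter s).toWord = [s] := FreeGroup.IsReduced.singleton.reduce_eq
    simp only [cone, Finset.mem_singleton, List.length_eq_zero_iff, exists_eq_right, ← hs,
      FreeGroup.toWord_inj]
  | succ n ih =>
    simp only [cone, Finset.mem_biUnion, Finset.mem_erase, Finset.mem_univ, and_true,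
      Finset.mem_image, ih]
    constructor
    · rintro ⟨s', hs', v, ⟨w, hv, hw⟩, rfl⟩
      have hred : FreeGroup.IsReduced (s :: v.toWord) :=
        hv ▸ isReduced_cons_cons_iff.2 ⟨hs', hv ▸ FreeGroup.isReduced_toWord⟩
      exact ⟨v.toWord, toWord_signedLetter_mul hred, by rw [hv, List.length_cons, hw]⟩
    · rintro ⟨w, hv, hw⟩
      obtain ⟨s', w, rfl⟩ := List.exists_cons_of_length_eq_add_one hw
      have hred := isReduced_cons_cons_iff.1 (hv ▸ FreeGroup.isReduced_toWord (x := v))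
      refine ⟨s', hred.1, FreeGroup.mk (s' :: w), ⟨w, ?_, by simpa using hw⟩, ?_⟩
      · rw [FreeGroup.toWord_mk, hred.2.reduce_eq]
      · rw [← mk_cons, ← hv, FreeGroup.mk_toWord]

theorem pairwiseDisjoint_cone (n : ℕ) (S : Set (A × Bool)) : S.PairwiseDisjoint (cone n) := by
  refine fun s _ s' _ hne => Finset.disjoint_left.2 fun v hv hv' => hne ?_
  obtain ⟨w, hw, -⟩ := mem_cone.1 hv
  obtain ⟨w', hw', -⟩ := mem_cone.1 hv'
  exact (List.cons.inj (hw.symm.trans hw')).1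

theorem sum_cone_succ {M : Type*} [AddCommMonoid M] (n : ℕ) (s : A × Bool)
    (g : FreeGroup A → M) : ∑ v ∈ cone (n + 1) s, g v
      = ∑ s' ∈ Finset.univ.erase (s.1, !s.2), ∑ v ∈ cone n s', g (signedLetter s * v) := by
  have hinj := mul_right_injective (signedLetter s)
  rw [cone, Finset.sum_biUnion]
  · exact Finset.sum_congr rfl fun s' _ => Finset.sum_image hinj.injOn
  · exact fun s₁ h₁ s₂ h₂ hne =>
      (Finset.disjoint_image hinj).2 (pairwiseDisjoint_cone n _ h₁ h₂ hne)

/-- The elements of length `n` of the free group. -/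
def sphere (A : Type*) [DecidableEq A] [Fintype A] : ℕ → Finset (FreeGroup A)
  | 0 => {1}
  | n + 1 => Finset.univ.biUnion (cone n)

theorem mem_sphere {n : ℕ} {v : FreeGroup A} : v ∈ sphere A n ↔ v.norm = n := by
  cases n with
  | zero => rw [sphere, Finset.mem_singleton, FreeGroup.norm_eq_zero]
  | succ n =>
    simp only [sphere, Finset.mem_biUnion, Finset.mem_univ, true_and, mem_cone, FreeGroup.norm,
      List.length_eq_succ_iff, eq_comm]

theorem sum_sphere_succ {M : Type*} [AddCommMonoid M] (n : ℕ) (g : FreeGroup A → M) :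
    ∑ v ∈ sphere A (n + 1), g v = ∑ s, ∑ v ∈ cone n s, g v :=
  Finset.sum_biUnion (pairwiseDisjoint_cone n _)

theorem card_cone (n : ℕ) (s : A × Bool) :
    (cone n s).card = (Fintype.card (A × Bool) - 1) ^ n := by
  induction n generalizing s with
  | zero => rfl
  | succ n ih =>
    rw [Finset.card_eq_sum_ones, sum_cone_succ]
    simp only [Finset.sum_const, ih, Finset.card_erase_of_mem (Finset.mem_univ _),
      Finset.card_univ, smul_eq_mul, mul_one, pow_succ']

theorem pow_le_card_sphere [Nonempty A] (n : ℕ) :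
    (Fintype.card (A × Bool) - 1) ^ n ≤ (sphere A n).card := by
  cases n with
  | zero => rfl
  | succ n =>
    rw [Finset.card_eq_sum_ones, sum_sphere_succ]
    simp only [card_cone, Finset.sum_const, Finset.card_univ, smul_eq_mul, mul_one, pow_succ']
    gcongr
    exact Nat.sub_le _ _

end Sphere

/-! ### Cogrowth -/

section Cogrowth

variable {A X : Type*} [Fintype A] [MulAction (FreeGroup A) X] {u : X → ℝ} {l : ℝ}

theorem nonempty_of_supersolution [Nonempty X] (hl : l < Fintype.card (A × Bool))
    (hpos : ∀ x, 0 < u x) (hu : ∀ x, ∑ s : A × Bool, u ((signedLetter s)⁻¹ • x) ≤ l * u x) :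
    Nonempty A := by
  by_contra hA
  rw [not_nonempty_iff] at hA
  obtain ⟨x⟩ := ‹Nonempty X›
  have h0 : 0 ≤ l * u x := by simpa only [Finset.univ_eq_empty, Finset.sum_empty] using hu x
  rw [Fintype.card_of_isEmpty, Nat.cast_zero] at hl
  exact (mul_neg_of_neg_of_pos hl (hpos x)).not_ge h0

theorem sum_erase_supersolution_le [DecidableEq A]
    (hu : ∀ x, ∑ s : A × Bool, u ((signedLetter s)⁻¹ • x) ≤ l * u x)
    (s : A × Bool) (x : X) :
    ∑ s' ∈ Finset.univ.erase (s.1, !s.2), u ((signedLetter s')⁻¹ • (signedLetter s)⁻¹ • x)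
      ≤ l * u ((signedLetter s)⁻¹ • x) - u x := by
  have h := hu ((signedLetter s)⁻¹ • x)
  rw [← Finset.sum_erase_add _ _ (Finset.mem_univ (s.1, !s.2)), signedLetter_not,
    inv_smul_smul] at h
  exact le_sub_right_of_add_le h

theorem card_univ_erase_not [DecidableEq A] [Nonempty A] (s : A × Bool) :
    ((Finset.univ.erase (s.1, !s.2)).card : ℝ) = Fintype.card (A × Bool) - 1 := by
  rw [Finset.card_erase_of_mem (Finset.mem_univ _), Finset.card_univ,
    Nat.cast_pred Fintype.card_pos]

theorem le_mul_of_mul_le_supersolution [Nonempty A] {c : ℝ}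
    (hu : ∀ x, ∑ s : A × Bool, u ((signedLetter s)⁻¹ • x) ≤ l * u x)
    (hc : ∀ (s : A × Bool) x, c * u x ≤ u ((signedLetter s)⁻¹ • x)) (s : A × Bool) (x : X) :
    u x ≤ (l - (Fintype.card (A × Bool) - 1) * c) * u ((signedLetter s)⁻¹ • x) := by
  classical
  have h := (Finset.card_nsmul_le_sum _ _ _ fun s' _ => hc s' ((signedLetter s)⁻¹ • x)).trans
    (sum_erase_supersolution_le hu s x)
  rw [nsmul_eq_mul, card_univ_erase_not] at h
  linarith

/-- With `q + 1` for the valency, the infimum `c` of the ratios `u y / u x` over neighbours `x` and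
`y` satisfies `1 ≤ c * (l - q * c)`, hence `(q * c - 1) * (c - 1) < 0`. -/
theorem exists_one_lt_mul_of_supersolution [Nonempty A] [Nonempty X]
    (hl : l < Fintype.card (A × Bool)) (hpos : ∀ x, 0 < u x)
    (hu : ∀ x, ∑ s : A × Bool, u ((signedLetter s)⁻¹ • x) ≤ l * u x) :
    ∃ c : ℝ, 1 < (Fintype.card (A × Bool) - 1) * c ∧
      ∀ (s : A × Bool) x, c * u x ≤ u ((signedLetter s)⁻¹ • x) := by
  set c : ℝ := ⨅ p : (A × Bool) × X, u ((signedLetter p.1)⁻¹ • p.2) / u p.2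
  set q : ℝ := Fintype.card (A × Bool) - 1 with hq_def
  have hratio : ∀ p : (A × Bool) × X, 0 ≤ u ((signedLetter p.1)⁻¹ • p.2) / u p.2 :=
    fun p => (div_pos (hpos _) (hpos _)).le
  have hc : ∀ (s : A × Bool) x, c * u x ≤ u ((signedLetter s)⁻¹ • x) := fun s x =>
    (le_div_iff₀ (hpos x)).1 (ciInf_le ⟨0, Set.forall_mem_range.2 hratio⟩ (s, x))
  have hle := le_mul_of_mul_le_supersolution hu hc
  have hdpos : 0 < l - q * c := by
    obtain ⟨⟨s, x⟩⟩ := (inferInstance : Nonempty ((A × Bool) × X))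
    exact pos_of_mul_pos_left ((hpos x).trans_le (hle s x)) (hpos _).le
  have hinv : (l - q * c)⁻¹ ≤ c := le_ciInf fun p =>
    (le_div_iff₀ (hpos p.2)).2 ((inv_mul_le_iff₀ hdpos).2 (hle p.1 p.2))
  have hcpos : 0 < c := (inv_pos.2 hdpos).trans_le hinv
  have hquad : 1 ≤ c * (l - q * c) := (inv_le_iff_one_le_mul₀ hdpos).1 hinv
  have hfactor : (q * c - 1) * (c - 1) < 0 := by nlinarith
  have hq : 1 ≤ q := by
    have : 2 ≤ Fintype.card (A × Bool) := by
      rw [Fintype.card_prod, Fintype.card_bool]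
      exact Nat.le_mul_of_pos_left 2 Fintype.card_pos
    rw [hq_def]
    exact le_sub_iff_add_le.2 (by exact_mod_cast this)
  exact ⟨c, by nlinarith, hc⟩

/-- The weights are `f s x = u (s⁻¹ • x) - t * u x`. With `q + 1` for the valency, they contract by
`t⁻¹` as soon as `l - q * t ≤ t⁻¹`; this is strict at `t = q⁻¹`, hence true of a larger `t`. -/
theorem exists_pos_contracting_of_supersolution [DecidableEq A] [Nonempty A] [Nonempty X]
    (hl : l < Fintype.card (A × Bool)) (hpos : ∀ x, 0 < u x)
    (hu : ∀ x, ∑ s : A × Bool, u ((signedLetter s)⁻¹ • x) ≤ l * u x) :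
    ∃ (f : A × Bool → X → ℝ) (r : ℝ), 0 < r ∧ r < Fintype.card (A × Bool) - 1 ∧
      (∀ s x, 0 < f s x) ∧
      ∀ s x, ∑ s' ∈ Finset.univ.erase (s.1, !s.2), f s' ((signedLetter s)⁻¹ • x) ≤ r * f s x := by
  obtain ⟨c, hqc, hc⟩ := exists_one_lt_mul_of_supersolution hl hpos hu
  have hcard := card_univ_erase_not (A := A)
  set q : ℝ := Fintype.card (A × Bool) - 1
  have hq : 0 < q := sub_pos.2 (by exact_mod_cast Fintype.one_lt_card)
  obtain ⟨t, htc, hlt, hqt⟩ : ∃ t : ℝ, t < c ∧ l * t < q * t ^ 2 + 1 ∧ q⁻¹ < t := by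
    have hlq : l * q⁻¹ < q * q⁻¹ ^ 2 + 1 := by
      field_simp
      linarith
    have h₁ : ∀ᶠ t in nhds q⁻¹, t < c := eventually_lt_nhds ((inv_lt_iff_one_lt_mul₀' hq).2 hqc)
    have h₂ : ∀ᶠ t in nhds q⁻¹, l * t < q * t ^ 2 + 1 :=
      ContinuousAt.eventually_lt (by fun_prop) (by fun_prop) hlq
    exact (((h₁.and h₂).filter_mono nhdsWithin_le_nhds).and
      (eventually_mem_nhdsWithin (s := Set.Ioi q⁻¹))).exists.imp fun t h => ⟨h.1.1, h.1.2, h.2⟩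
  have ht : 0 < t := (inv_pos.2 hq).trans hqt
  refine ⟨fun s x => u ((signedLetter s)⁻¹ • x) - t * u x, t⁻¹, inv_pos.2 ht,
    inv_lt_of_inv_lt₀ hq hqt, fun s x => sub_pos.2 ?_, fun s x => ?_⟩
  · exact ((mul_lt_mul_iff_left₀ (hpos x)).2 htc).trans_le (hc s x)
  · have hle := sum_erase_supersolution_le hu s x
    have hlqt : l - q * t ≤ t⁻¹ := by
      rw [← one_div, le_div_iff₀ ht]
      linarith
    have := mul_le_mul_of_nonneg_right hlqt (hpos ((signedLetter s)⁻¹ • x)).le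
    rw [Finset.sum_sub_distrib, Finset.sum_const, nsmul_eq_mul, hcard, mul_sub,
      inv_mul_cancel_left₀ ht.ne']
    linarith

theorem exists_card_cone_filter_smul_eq_le [DecidableEq A] [DecidableEq X]
    {f : A × Bool → X → ℝ} {r : ℝ} (hr : 0 ≤ r)
    (hpos : ∀ s x, 0 < f s x)
    (hf : ∀ s x, ∑ s' ∈ Finset.univ.erase (s.1, !s.2), f s' ((signedLetter s)⁻¹ • x) ≤ r * f s x)
    (x₀ : X) : ∃ K : ℝ, 0 ≤ K ∧ ∀ n s x,
      ((cone n s).filter (· • x₀ = x)).card ≤ K * r ^ n * f s x := by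
  have hnonneg : ∀ s : A × Bool, 0 ≤ (f s (signedLetter s • x₀))⁻¹ :=
    fun s => (inv_pos.2 (hpos _ _)).le
  set K := ∑ s : A × Bool, (f s (signedLetter s • x₀))⁻¹
  have hK : 0 ≤ K := Finset.sum_nonneg fun s _ => hnonneg s
  refine ⟨K, hK, fun n => ?_⟩
  induction n with
  | zero =>
    intro s x
    rw [cone, Finset.filter_singleton, pow_zero, mul_one]
    split_ifs with hx
    · subst hx
      rw [Finset.card_singleton, Nat.cast_one, ← inv_mul_cancel₀ (hpos s _).ne']
      exact mul_le_mul_of_nonneg_right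
        (Finset.single_le_sum (fun s _ => hnonneg s) (Finset.mem_univ s)) (hpos _ _).le
    · rw [Finset.card_empty, Nat.cast_zero]
      exact mul_nonneg hK (hpos _ _).le
  | succ n ih =>
    intro s x
    calc (((cone (n + 1) s).filter (· • x₀ = x)).card : ℝ)
        = ∑ s' ∈ Finset.univ.erase (s.1, !s.2),
            (((cone n s').filter (· • x₀ = (signedLetter s)⁻¹ • x)).card : ℝ) := by
          simp only [Finset.card_filter, sum_cone_succ, mul_smul, eq_inv_smul_iff, Nat.cast_sum]
      _ ≤ ∑ s' ∈ Finset.univ.erase (s.1, !s.2), K * r ^ n * f s' ((signedLetter s)⁻¹ • x) :=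
          Finset.sum_le_sum fun s' _ => ih s' _
      _ ≤ K * r ^ n * (r * f s x) := by
          rw [← Finset.mul_sum]
          exact mul_le_mul_of_nonneg_left (hf s x) (by positivity)
      _ = K * r ^ (n + 1) * f s x := by ring

theorem exists_card_sphere_filter_smul_eq_le_mul_pow [DecidableEq A] [DecidableEq X]
    {f : A × Bool → X → ℝ} {r : ℝ} (hr : 0 < r) (hpos : ∀ s x, 0 < f s x)
    (hf : ∀ s x, ∑ s' ∈ Finset.univ.erase (s.1, !s.2), f s' ((signedLetter s)⁻¹ • x) ≤ r * f s x)
    (x₀ : X) : ∃ C : ℝ, 0 ≤ C ∧ ∀ n,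
      ((sphere A n).filter (· • x₀ = x₀)).card ≤ C * r ^ n := by
  obtain ⟨K, hK, hcone⟩ := exists_card_cone_filter_smul_eq_le hr.le hpos hf x₀
  have hS : 0 ≤ ∑ s, f s x₀ := Finset.sum_nonneg fun s _ => (hpos s x₀).le
  refine ⟨1 + K * (∑ s, f s x₀) / r, by positivity, ?_⟩
  rintro (- | n)
  · rw [sphere, Finset.filter_singleton, if_pos (one_smul _ x₀), Finset.card_singleton,
      Nat.cast_one, pow_zero, mul_one]
    exact le_add_of_nonneg_right (by positivity)
  · calc (((sphere A (n + 1)).filter (· • x₀ = x₀)).card : ℝ)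
        = ∑ s, (((cone n s).filter (· • x₀ = x₀)).card : ℝ) := by
          simp only [Finset.card_filter, sum_sphere_succ, Nat.cast_sum]
      _ ≤ ∑ s, K * r ^ n * f s x₀ := Finset.sum_le_sum fun s _ => hcone n s x₀
      _ = K * (∑ s, f s x₀) / r * r ^ (n + 1) := by
          rw [← Finset.mul_sum]
          field_simp
          ring
      _ ≤ (1 + K * (∑ s, f s x₀) / r) * r ^ (n + 1) := by
          gcongr
          exact le_add_of_nonneg_left zero_le_one

theorem exists_card_sphere_filter_smul_eq_le [DecidableEq A] [DecidableEq X]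
    (hl : l < Fintype.card (A × Bool)) (hpos : ∀ x, 0 < u x)
    (hu : ∀ x, ∑ s : A × Bool, u ((signedLetter s)⁻¹ • x) ≤ l * u x) (x₀ : X) :
    ∃ C r : ℝ≥0, 0 < r ∧ r < 1 ∧ ∀ n,
      ((sphere A n).filter (· • x₀ = x₀)).card ≤ C * r ^ n * (sphere A n).card := by
  have : Nonempty X := ⟨x₀⟩
  have : Nonempty A := nonempty_of_supersolution hl hpos hu
  obtain ⟨f, r, hr, hrq, hfpos, hf⟩ := exists_pos_contracting_of_supersolution hl hpos hu
  obtain ⟨C, hC, hcount⟩ := exists_card_sphere_filter_smul_eq_le_mul_pow hr hfpos hf x₀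
  rw [← Nat.cast_pred Fintype.card_pos] at hrq
  lift C to ℝ≥0 using hC
  lift r to ℝ≥0 using hr.le
  norm_cast at hr hrq hcount
  have hsphere : ∀ n, ((Fintype.card (A × Bool) - 1 : ℕ) : ℝ≥0) ^ n ≤ (sphere A n).card :=
    fun n => by exact_mod_cast pow_le_card_sphere n
  set q : ℝ≥0 := ((Fintype.card (A × Bool) - 1 : ℕ) : ℝ≥0)
  have hq : 0 < q := hr.trans hrq
  refine ⟨C, r / q, div_pos hr hq, (div_lt_one hq).2 hrq, fun n => (hcount n).trans ?_⟩
  calc C * r ^ n = C * (r / q) ^ n * q ^ n := by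
        rw [mul_assoc, ← mul_pow, div_mul_cancel₀ r hq.ne']
    _ ≤ C * (r / q) ^ n * (sphere A n).card := mul_le_mul_right (hsphere n) _

end Cogrowth

open Classical in
theorem exists_card_sphere_filter_mem_le {A G : Type*} [Fintype A] [DecidableEq A]
    [Group G] {π : A → G} (hπ : IsGeneratingFamily π) {N : Subgroup G}
    (hN : HasBoundedDoubling G (G ⧸ N)) : ∃ C r : ℝ≥0, 0 < r ∧ r < 1 ∧ ∀ n,
      ((sphere A n).filter (FreeGroup.lift π · ∈ N)).card ≤ C * r ^ n * (sphere A n).card := by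
  obtain ⟨u, l, hl, hpos, hu⟩ := exists_pos_supersolution hπ hN
  let _ : MulAction (FreeGroup A) (G ⧸ N) := MulAction.compHom _ (FreeGroup.lift π)
  have hsmul : ∀ (v : FreeGroup A) (x : G ⧸ N), v • x = FreeGroup.lift π v • x := fun _ _ => rfl
  have hu' : ∀ x : G ⧸ N, ∑ s : A × Bool, u ((signedLetter s)⁻¹ • x) ≤ l * u x := fun x => by
    refine le_of_eq_of_le ?_ (hu x)
    simp only [Fintype.sum_prod_type, Fintype.sum_bool, hsmul, signedLetter, map_inv,
      FreeGroup.lift_mk, List.map_cons, List.map_nil, List.prod_singleton, cond_true, cond_false,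
      inv_inv, add_comm]
  have hcard : (Fintype.card (A × Bool) : ℝ) = 2 * Fintype.card A := by
    rw [Fintype.card_prod, Fintype.card_bool, Nat.cast_mul, Nat.cast_ofNat, mul_comm]
  obtain ⟨C, r, hr, hr', hle⟩ :=
    exists_card_sphere_filter_smul_eq_le (hcard ▸ hl) hpos hu' ((1 : G) : G ⧸ N)
  refine ⟨C, r, hr, hr', fun n => le_of_eq_of_le ?_ (hle n)⟩
  simp only [hsmul, MulAction.Quotient.smul_coe, smul_eq_mul, mul_one, QuotientGroup.eq,
    inv_mem_iff]

/-! ### Averages over length-invariant measures -/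

section Average

variable {A : Type*} [Fintype A] [DecidableEq A]

theorem tsum_eq_tsum_sum_sphere (F : FreeGroup A → ℝ≥0∞) :
    ∑' v, F v = ∑' n, ∑ v ∈ sphere A n, F v := by
  have hsum : ∀ v, F v = ∑' n, if v.norm = n then F v else 0 := fun v => by
    rw [tsum_eq_single v.norm fun n hn => if_neg hn.symm, if_pos rfl]
  rw [tsum_congr hsum, ENNReal.tsum_comm]
  refine tsum_congr fun n => ?_
  rw [tsum_eq_sum fun v hv => if_neg fun h => hv (mem_sphere.2 h)]
  exact Finset.sum_congr rfl fun v hv => if_pos (mem_sphere.1 hv)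

theorem IsLengthInvariant.tsum_mul_le {μ : PMF (FreeGroup A)} (hμ : IsLengthInvariant μ)
    {g : FreeGroup A → ℝ≥0∞} {C : ℝ≥0∞}
    (hg : ∀ n, ∑ v ∈ sphere A n, g v ≤ C * (sphere A n).card) : ∑' v, g v * μ v ≤ C := by
  have hconst : ∀ n, ∃ m, ∀ v ∈ sphere A n, μ v = m := fun n => by
    rcases (sphere A n).eq_empty_or_nonempty with h | ⟨v₀, h₀⟩
    · exact ⟨0, by simp only [h, Finset.notMem_empty, false_imp_iff, implies_true]⟩
    · exact ⟨μ v₀, fun v h => hμ v v₀ ((mem_sphere.1 h).trans (mem_sphere.1 h₀).symm)⟩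
  calc ∑' v, g v * μ v = ∑' n, ∑ v ∈ sphere A n, g v * μ v := tsum_eq_tsum_sum_sphere _
    _ ≤ ∑' n, C * ∑ v ∈ sphere A n, μ v := ENNReal.tsum_le_tsum fun n => by
      obtain ⟨m, hm⟩ := hconst n
      rw [Finset.sum_congr rfl hm, Finset.sum_congr rfl fun v hv => by rw [hm v hv],
        ← Finset.sum_mul, Finset.sum_const, nsmul_eq_mul, ← mul_assoc]
      exact mul_le_mul_left (hg n) m
    _ = C := by rw [ENNReal.tsum_mul_left, ← tsum_eq_tsum_sum_sphere, μ.tsum_coe, mul_one]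

theorem MultiTapeTM.Decides.solvesOnAverage {M : MultiTapeTM (A × Bool)} {L : Language (A × Bool)}
    (hM : M.Decides L) {f : ℕ → ℕ} (hf : Monotone f) (hpos : ∀ n, 0 < f n)
    {g : FreeGroup A → ℝ≥0∞} (htime : ∀ v : FreeGroup A, M.time v.toWord ≤ f v.norm + g v)
    {C : ℝ≥0} (hg : ∀ n, ∑ v ∈ sphere A n, g v ≤ C * (sphere A n).card) :
    M.SolvesOnAverage L f {μ | IsLengthInvariant μ} := by
  refine ⟨hM, hf, hpos, 1 + C, by positivity, fun μ hμ => ?_⟩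
  have hdiv : ∀ v : FreeGroup A, M.time v.toWord / (f v.norm : ℝ≥0∞) ≤ 1 + g v := fun v => by
    have hone : (1 : ℝ≥0∞) ≤ f v.norm := by exact_mod_cast hpos v.norm
    refine ENNReal.div_le_of_le_mul ((htime v).trans ?_)
    rw [one_add_mul]
    exact add_le_add_right (le_mul_of_one_le_right' hone) _
  calc ∑' v : FreeGroup A, M.time v.toWord / (f v.norm : ℝ≥0∞) * μ v
      ≤ ∑' v, (μ v + g v * μ v) := ENNReal.tsum_le_tsum fun v => by
        rw [← one_add_mul]
        exact mul_le_mul_left (hdiv v) _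
    _ = 1 + ∑' v, g v * μ v := by rw [ENNReal.tsum_add, μ.tsum_coe]
    _ ≤ ↑(1 + C) := by
        rw [ENNReal.coe_add, ENNReal.coe_one]
        exact add_le_add_right (IsLengthInvariant.tsum_mul_le hμ hg) 1

end Average

theorem IsSubexponential.exists_le_mul_pow {f : ℕ → ℝ≥0} (hf : IsSubexponential f) {r : ℝ≥0}
    (hr : 1 < r) : ∃ K : ℝ≥0, ∀ n, f n ≤ K * r ^ n := by
  obtain ⟨K, hK⟩ := (hf r hr).bddAbove_range
  refine ⟨K.toNNReal, fun n => ?_⟩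
  have hpow : 0 < r ^ n := pow_pos (zero_lt_one.trans hr) n
  rw [← div_le_iff₀ hpow, ← NNReal.coe_le_coe]
  push_cast
  exact (hK ⟨n, rfl⟩).trans (Real.le_coe_toNNReal K)

theorem IsSubexponential.exists_le_mul_pow_of_le_mul {f : ℕ → ℝ≥0} (hf : IsSubexponential f)
    {r : ℝ≥0} (hr : 1 < r) (L : ℕ) : ∃ K : ℝ≥0, ∀ n m, m ≤ L * n → f m ≤ K * r ^ n := by
  obtain ⟨s, hs, hsL⟩ : ∃ s : ℝ≥0, 1 < s ∧ s ^ L ≤ r := by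
    have hlim : Filter.Tendsto (fun s : ℝ≥0 => s ^ L) (nhds 1) (nhds 1) := by
      simpa only [one_pow] using (continuous_pow L).tendsto (1 : ℝ≥0)
    exact (eventually_mem_nhdsWithin.and
      (nhdsWithin_le_nhds (s := Set.Ioi 1) (hlim.eventually_le_const hr))).exists
  obtain ⟨K, hK⟩ := hf.exists_le_mul_pow hs
  refine ⟨K, fun n m hm => (hK m).trans (mul_le_mul_right ?_ K)⟩
  calc s ^ m ≤ s ^ (L * n) := pow_le_pow_right₀ hs.le hm
    _ = (s ^ L) ^ n := pow_mul s L n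
    _ ≤ r ^ n := pow_le_pow_left₀ zero_le hsL n

open Classical in
theorem MultiTapeTM.Decides.solvesOnAverage_of_time_le {A G : Type*} [Finite A] [DecidableEq A]
    [Group G] {π : A → G} (hπ : IsGeneratingFamily π) {N : Subgroup G}
    (hN : HasBoundedDoubling G (G ⧸ N)) {M : MultiTapeTM (A × Bool)} {L : Language (A × Bool)}
    (hM : M.Decides L) {f : ℕ → ℕ} (hf : Monotone f) (hpos : ∀ n, 0 < f n)
    {g : ℕ → ℝ≥0} (hg : IsSubexponential g) (l : ℕ)
    (htime : ∀ v : FreeGroup A, ∃ m ≤ l * v.norm,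
      M.time v.toWord ≤ f v.norm + if FreeGroup.lift π v ∈ N then (g m : ℝ≥0∞) else 0) :
    M.SolvesOnAverage L f {μ | IsLengthInvariant μ} := by
  have := Fintype.ofFinite A
  obtain ⟨C, r, hr, hr', hcard⟩ := exists_card_sphere_filter_mem_le hπ hN
  obtain ⟨K, hK⟩ := hg.exists_le_mul_pow_of_le_mul ((one_lt_inv₀ hr).2 hr') l
  refine hM.solvesOnAverage hf hpos (C := C * K)
    (g := fun v => if FreeGroup.lift π v ∈ N then ((K * r⁻¹ ^ v.norm : ℝ≥0) : ℝ≥0∞) else 0)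
    (fun v => ?_) fun n => ?_
  · obtain ⟨m, hm, hle⟩ := htime v
    refine hle.trans (add_le_add_right ?_ _)
    split_ifs
    · exact ENNReal.coe_le_coe.2 (hK _ m hm)
    · exact le_rfl
  · rw [← Finset.sum_filter, Finset.sum_congr rfl fun v hv => by
      rw [mem_sphere.1 (Finset.mem_filter.1 hv).1], Finset.sum_const, nsmul_eq_mul]
    norm_cast
    calc ((sphere A n).filter (FreeGroup.lift π · ∈ N)).card * (K * r⁻¹ ^ n)
        ≤ C * r ^ n * (sphere A n).card * (K * r⁻¹ ^ n) := mul_le_mul_left (hcard n) _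
      _ = C * K * (sphere A n).card * (r * r⁻¹) ^ n := by rw [mul_pow]; ring
      _ = C * K * (sphere A n).card := by rw [mul_inv_cancel₀ hr.ne', one_pow, mul_one]

/-! ### Running times and subroutines -/

namespace MultiTapeTM

variable {X Y : Type*}

section Step

variable (M : MultiTapeTM X)

theorem step_of_halted {c : M.Cfg} {b : Bool} (h : c.status = Sum.inr b) : M.step c = c := by
  simp only [step, h]

theorem step_eq {c : M.Cfg} {q : M.State} (h : c.status = Sum.inl q)
    {a : (M.State ⊕ Bool) × (Option M.Work → M.Symbol × Option Turing.Dir)}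
    (ha : M.δ q (fun i => (c.tape i).head) = a) :
    M.step c = ⟨a.1, fun i => M.act (c.tape i) (a.2 i)⟩ := by
  simp only [step, h, ha]

theorem act_stay (T : Turing.Tape M.Symbol) : M.act T (T.head, none) = T :=
  Turing.Tape.write_self T

theorem act_move (T : Turing.Tape M.Symbol) (d : Turing.Dir) :
    M.act T (T.head, some d) = T.move d :=
  congrArg (Turing.Tape.move d) (Turing.Tape.write_self T)

theorem map_act (N : MultiTapeTM Y) (f : Turing.PointedMap M.Symbol N.Symbol)
    (T : Turing.Tape M.Symbol) (a : M.Symbol × Option Turing.Dir) :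
    (M.act T a).map f = N.act (T.map f) (Prod.map f id a) := by
  obtain ⟨s, - | d⟩ := a
  · exact Turing.Tape.map_write f s T
  · exact (Turing.Tape.map_move f (T.write s) d).trans
      (congrArg _ (Turing.Tape.map_write f s T))

end Step

section Time

variable {M : MultiTapeTM X} {w : List X} {b b' : Bool} {s t : ℕ}

theorem HaltsWith.mono (h : M.HaltsWith w b s) (hst : s ≤ t) : M.HaltsWith w b t := by
  obtain ⟨k, rfl⟩ := Nat.exists_eq_add_of_le' hst
  rw [HaltsWith, run] at h ⊢
  rwa [Function.iterate_add_apply, Function.iterate_fixed (M.step_of_halted h)]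

theorem HaltsWith.unique (h : M.HaltsWith w b s) (h' : M.HaltsWith w b' t) : b = b' :=
  Sum.inr.inj ((h.mono (le_max_left s t)).symm.trans (h'.mono (le_max_right s t)))

theorem HaltsWith.time_le (h : M.HaltsWith w b t) : M.time w ≤ t :=
  iInf₂_le t ⟨b, h⟩

theorem HaltsWith.exists_time_eq (h : M.HaltsWith w b t) :
    ∃ s : ℕ, M.time w = s ∧ M.HaltsWith w b s := by
  classical
  have hex : ∃ s, ∃ b, M.HaltsWith w b s := ⟨t, b, h⟩
  obtain ⟨b', hb'⟩ := Nat.find_spec hex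
  refine ⟨Nat.find hex, hb'.time_le.antisymm (le_iInf₂ fun s hs => ?_), h.unique hb' ▸ hb'⟩
  exact Nat.cast_le.2 (Nat.find_min' hex hs)

open Classical in
theorem decides_iff {L : Language X} :
    M.Decides L ↔ ∀ w, ∃ t, M.HaltsWith w (decide (w ∈ L)) t := by
  refine forall_congr' fun w => ?_
  by_cases hw : w ∈ L <;>
    simp only [hw, decide_true, decide_false, true_imp_iff, false_imp_iff, not_true_eq_false,
      not_false_eq_true, and_true, true_and]

end Time

/-- A copy of `M` inside `N`: in the states `state q`, the machine `N` acts on the tapes `tape k`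
as `M` does in the state `q`, up to the translation `symbol` of symbols, and leaves its other tapes
alone. When `M` halts with the verdict `b`, then `N` passes to `exit b`. -/
structure Subroutine (N : MultiTapeTM X) (M : MultiTapeTM Y) where
  state : M.State → N.State
  tape : Option M.Work → Option N.Work
  symbol : Turing.PointedMap N.Symbol M.Symbol
  exit : Bool → N.State ⊕ Bool
  δ_status : ∀ q r, (N.δ (state q) r).1
    = Sum.elim (Sum.inl ∘ state) exit (M.δ q fun k => symbol (r (tape k))).1
  δ_tape : ∀ q r k, Prod.map symbol id ((N.δ (state q) r).2 (tape k))
    = (M.δ q fun k => symbol (r (tape k))).2 k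
  δ_other : ∀ q r, ∀ j ∉ Set.range tape, (N.δ (state q) r).2 j = (r j, none)

namespace Subroutine

variable {N : MultiTapeTM X} {M : MultiTapeTM Y} (S : Subroutine N M)

/-- The configuration `C` of `N` represents the configuration `c` of the copy of `M`. -/
structure Simulates (C : N.Cfg) (c : M.Cfg) : Prop where
  status : C.status = Sum.elim (Sum.inl ∘ S.state) S.exit c.status
  tape : ∀ k, (C.tape (S.tape k)).map S.symbol = c.tape k

variable {S} {C : N.Cfg} {c : M.Cfg}

theorem Simulates.step (h : S.Simulates C c) {q : M.State} (hq : c.status = Sum.inl q) :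
    S.Simulates (N.step C) (M.step c) ∧
      ∀ j ∉ Set.range S.tape, (N.step C).tape j = C.tape j := by
  have hC : C.status = Sum.inl (S.state q) := by rw [h.status, hq, Sum.elim_inl,
    Function.comp_apply]
  have hread : (fun k => S.symbol (C.tape (S.tape k)).head) = fun k => (c.tape k).head := by
    simp only [← h.tape, Turing.Tape.map_fst]
  rw [N.step_eq hC rfl, M.step_eq hq rfl]
  refine ⟨⟨?_, fun k => ?_⟩, fun j hj => ?_⟩
  · rw [S.δ_status, hread]
  · rw [N.map_act M, S.δ_tape, hread, h.tape]
  · exact (congrArg (N.act _) (S.δ_other _ _ j hj)).trans (N.act_stay _)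

theorem Simulates.exists_iterate_step (h : S.Simulates C c) (t : ℕ) :
    ∃ t' ≤ t, S.Simulates (N.step^[t'] C) (M.step^[t] c) ∧
      ∀ j ∉ Set.range S.tape, (N.step^[t'] C).tape j = C.tape j := by
  induction t with
  | zero => exact ⟨0, le_rfl, h, fun _ _ => rfl⟩
  | succ t ih =>
    obtain ⟨t', ht', hsim, hother⟩ := ih
    rw [Function.iterate_succ_apply']
    rcases hq : (M.step^[t] c).status with q | b
    · refine ⟨t' + 1, Nat.succ_le_succ ht', ?_⟩
      rw [Function.iterate_succ_apply']
      obtain ⟨hsim', hother'⟩ := hsim.step hq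
      exact ⟨hsim', fun j hj => (hother' j hj).trans (hother j hj)⟩
    · rw [M.step_of_halted hq]
      exact ⟨t', ht'.trans (Nat.le_succ t), hsim, hother⟩

end Subroutine

end MultiTapeTM

/-! ### Transducing the input and running two machines in succession -/

/-- The tape that results from writing the word `l` leftwards, starting from a blank tape: the head
is on the blank cell to the left of `l`. -/
def pushTape {Γ : Type*} [Inhabited Γ] (l : List Γ) : Turing.Tape Γ :=
  ⟨default, Turing.ListBlank.mk [], Turing.ListBlank.mk l⟩

theorem pushTape_nil {Γ : Type*} [Inhabited Γ] :
    (pushTape [] : Turing.Tape Γ) = Turing.Tape.mk₁ [] :=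
  rfl

theorem pushTape_move_right {Γ : Type*} [Inhabited Γ] (l : List Γ) :
    (pushTape l).move Turing.Dir.right = Turing.Tape.mk₁ l :=
  congrArg (Turing.Tape.mk' · (Turing.ListBlank.mk l))
    (Turing.ListBlank.cons_head_tail (Turing.ListBlank.mk []))

/-- A deterministic finite automaton which, on every letter it reads, emits a word over each of the
alphabets `Y b`. -/
structure Transducer (X σ : Type*) {ι : Type*} (Y : ι → Type*) extends DFA X σ where
  emit : ∀ b, σ → X → List (Y b)

namespace Transducer

variable {X σ ι : Type*} {Y : ι → Type*} (D : Transducer X σ Y)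

/-- The outputs on a word that is read from a given state. Emitted words are prepended, so that a
Turing machine can write the outputs from right to left. -/
def outputFrom (b : ι) : σ → List X → List (Y b)
  | _, [] => []
  | q, x :: w => outputFrom b (D.step q x) w ++ D.emit b q x

/-- The outputs on a word that is read from the initial state. -/
def output (b : ι) (w : List X) : List (Y b) := D.outputFrom b D.start w

theorem length_outputFrom_le {b : ι} {L : ℕ} (hL : ∀ q x, (D.emit b q x).length ≤ L) (q : σ)
    (w : List X) : (D.outputFrom b q w).length ≤ L * w.length := by
  induction w generalizing q with
  | nil => exact Nat.zero_le _
  | cons x w ih =>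
    rw [outputFrom, List.length_append, List.length_cons, Nat.mul_succ]
    exact Nat.add_le_add (ih _) (hL q x)

theorem exists_length_emit_le [Finite X] [Finite σ] [Finite ι] :
    ∃ L, ∀ b q x, (D.emit b q x).length ≤ L := by
  obtain ⟨L, hL⟩ := (Set.finite_range fun p : ι × σ × X =>
    (D.emit p.1 p.2.1 p.2.2).length).bddAbove
  exact ⟨L, fun b q x => hL ⟨(b, q, x), rfl⟩⟩

end Transducer

namespace MultiTapeTM

theorem act_pushTape {X : Type*} (M : MultiTapeTM X) (y : Option X) (l : List X) :
    M.act (pushTape (l.map M.letter)) (y.elim default M.letter, y.map fun _ => Turing.Dir.left)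
      = pushTape ((y.toList ++ l).map M.letter) := by
  cases y <;> rfl

section Cascade

variable {X σ : Type*} [Finite X] [Finite σ] {Y : Bool → Type*} (D : Transducer X σ Y) (L : ℕ)
  (M : ∀ b, MultiTapeTM (Y b))

/-- The work tapes of `cascade`: all tapes of both machines. -/
abbrev CascadeWork : Type := Σ b, Option (M b).Work

/-- The tape alphabet of `cascade`: a letter of the input, and symbols of both machines. -/
abbrev CascadeSymbol (X : Type*) [Finite X] {Y : Bool → Type*} (M : ∀ b, MultiTapeTM (Y b)) :
    Type :=
  Option (Fin (Nat.card X)) × ∀ b, (M b).Symbol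

/-- The states of `cascade`: in the state `(q, j)` the transducer is in the state `q` and all but
the first `j` letters that it emits on the scanned letter have been written. -/
abbrev CascadeState (σ : Type*) [Finite σ] (L : ℕ) {Y : Bool → Type*}
    (M : ∀ b, MultiTapeTM (Y b)) : Type :=
  (Fin (Nat.card σ) × Fin (L + 1)) ⊕ Σ b, (M b).State

variable {M}

open Classical in
/-- The symbol `y` of the machine `M b` as a tape symbol of `cascade`. -/
noncomputable def cascadeCell (b : Bool) (y : (M b).Symbol) : CascadeSymbol X M :=
  (none, Function.update default b y)

/-- The actions that write a letter of the outputs. -/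
noncomputable def cascadeEmit (y : ∀ b, Option (Y b))
    (r : Option (CascadeWork M) → CascadeSymbol X M) :
    Option (CascadeWork M) → CascadeSymbol X M × Option Turing.Dir
  | some ⟨b, none⟩ =>
      (cascadeCell b ((y b).elim default (M b).letter), (y b).map fun _ => Turing.Dir.left)
  | j => (r j, none)

/-- The actions that move the head of the input tape to the next letter. -/
def cascadeNext (r : Option (CascadeWork M) → CascadeSymbol X M) :
    Option (CascadeWork M) → CascadeSymbol X M × Option Turing.Dir
  | none => (r none, some Turing.Dir.right)
  | j => (r j, none)

/-- The actions that move the heads to the beginnings of the outputs. -/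
def cascadeRewind (r : Option (CascadeWork M) → CascadeSymbol X M) :
    Option (CascadeWork M) → CascadeSymbol X M × Option Turing.Dir
  | some ⟨b, none⟩ => (r (some ⟨b, none⟩), some Turing.Dir.right)
  | j => (r j, none)

/-- The actions `a` of the machine `M b`, performed by `cascade`. -/
noncomputable def cascadeRun (b : Bool)
    (a : Option (M b).Work → (M b).Symbol × Option Turing.Dir)
    (r : Option (CascadeWork M) → CascadeSymbol X M) :
    Option (CascadeWork M) → CascadeSymbol X M × Option Turing.Dir :=
  Function.extend (fun k => some ⟨b, k⟩) (fun k => (cascadeCell b (a k).1, (a k).2))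
    fun k => (r k, none)

variable (M) in
/-- What happens when a machine halts: if `M false` accepts, then `M true` is started. -/
def cascadeExit : Bool → Bool → CascadeState σ L M ⊕ Bool
  | false, true => Sum.inl (Sum.inr ⟨true, (M true).start⟩)
  | _, v => Sum.inr v

variable (M)

open Classical in
/-- The transition function of `cascade`. -/
noncomputable def cascadeTransition :
    CascadeState σ L M → (Option (CascadeWork M) → CascadeSymbol X M) →
      (CascadeState σ L M ⊕ Bool) ×
        (Option (CascadeWork M) → CascadeSymbol X M × Option Turing.Dir)
  | Sum.inl (q, j), r =>
    let q := (Finite.equivFin σ).symm q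
    match (r none).1 with
    | none =>
      if q ∈ D.accept then
        (Sum.inl (Sum.inr ⟨false, (M false).start⟩), cascadeRewind r)
      else (Sum.inr false, fun k => (r k, none))
    | some x =>
      let x := (Finite.equivFin X).symm x
      Fin.cases
        (Sum.inl (Sum.inl (Finite.equivFin σ (D.step q x), Fin.last L)),
          cascadeNext r)
        (fun j => (Sum.inl (Sum.inl (Finite.equivFin σ q, j.castSucc)),
          cascadeEmit (fun b => (D.emit b q x)[j.1]?) r)) j
  | Sum.inr ⟨b, q⟩, r =>
    let a := (M b).δ q fun k => (r (some ⟨b, k⟩)).2 b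
    (Sum.elim (fun q' => Sum.inl (Sum.inr ⟨b, q'⟩)) (cascadeExit L M b) a.1,
      cascadeRun b a.2 r)

/-- The machine that writes the outputs of the transducer `D`, which emits at most `L` letters at a
time, on two work tapes, rejects unless the automaton `D` accepts the input, runs `M false` on the
first output, rejects if `M false` does so, and otherwise runs `M true` on the second output. -/
noncomputable abbrev cascade : MultiTapeTM X where
  Work := CascadeWork M
  Symbol := CascadeSymbol X M
  State := CascadeState σ L M
  finiteWork := by
    have := fun b => (M b).finiteWork
    infer_instance
  finiteSymbol := by
    have := fun b => (M b).finiteSymbol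
    infer_instance
  finiteState := by
    have := fun b => (M b).finiteState
    infer_instance
  inhabitedSymbol := inferInstance
  start := Sum.inl (Finite.equivFin σ D.start, Fin.last L)
  letter := ⟨fun x => (some (Finite.equivFin X x), default), fun x y h =>
    (Finite.equivFin X).injective (Option.some_injective _ (congrArg Prod.fst h))⟩
  letter_ne_blank x h := Option.some_ne_none _ (congrArg Prod.fst h)
  δ := cascadeTransition D L M

/-- The symbols of the machine `M b` on the tapes of `cascade`. -/
def cascadeProj (b : Bool) : Turing.PointedMap (cascade D L M).Symbol (M b).Symbol :=
  ⟨fun s => s.2 b, rfl⟩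

theorem map_cascadeCell (b : Bool) (y : (M b).Symbol) (d : Option Turing.Dir) :
    Prod.map (cascadeProj D L M b) id (cascadeCell b y, d) = (y, d) :=
  Prod.ext (Function.update_self (β := fun b => (M b).Symbol) b y default) rfl

section Transition

variable {D L M} {r : Option (CascadeWork M) → CascadeSymbol X M} {q : σ} {x : X}

theorem cascadeRun_apply (b : Bool) (a : Option (M b).Work → (M b).Symbol × Option Turing.Dir)
    (k : Option (M b).Work) : cascadeRun b a r (some ⟨b, k⟩) = (cascadeCell b (a k).1, (a k).2) :=
  have hinj : Function.Injective fun k : Option (M b).Work => some (⟨b, k⟩ : CascadeWork M) :=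
    fun _ _ h => by simpa using h
  hinj.extend_apply _ _ k

theorem cascadeRun_of_notMem_range {b : Bool}
    (a : Option (M b).Work → (M b).Symbol × Option Turing.Dir) {j : Option (CascadeWork M)}
    (hj : j ∉ Set.range fun k : Option (M b).Work => some ⟨b, k⟩) :
    cascadeRun b a r j = (r j, none) :=
  Function.extend_apply' _ _ j hj

theorem δ_cascade_emit (hr : (r none).1 = some (Finite.equivFin X x)) (j : Fin L) :
    (cascade D L M).δ (Sum.inl (Finite.equivFin σ q, j.succ)) r
      = (Sum.inl (Sum.inl (Finite.equivFin σ q, j.castSucc)),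
        cascadeEmit (fun b => (D.emit b q x)[j.1]?) r) := by
  simp only [cascadeTransition, hr, Equiv.symm_apply_apply, Fin.cases_succ]

theorem δ_cascade_next (hr : (r none).1 = some (Finite.equivFin X x)) :
    (cascade D L M).δ (Sum.inl (Finite.equivFin σ q, 0)) r
      = (Sum.inl (Sum.inl (Finite.equivFin σ (D.step q x), Fin.last L)),
        cascadeNext r) := by
  simp only [cascadeTransition, hr, Equiv.symm_apply_apply, Fin.cases_zero]

theorem δ_cascade_rewind (hr : (r none).1 = none) (hq : q ∈ D.accept) (j : Fin (L + 1)) :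
    (cascade D L M).δ (Sum.inl (Finite.equivFin σ q, j)) r
      = (Sum.inl (Sum.inr ⟨false, (M false).start⟩), cascadeRewind r) := by
  simp only [cascadeTransition, hr, Equiv.symm_apply_apply, hq, if_true]

theorem δ_cascade_reject (hr : (r none).1 = none) (hq : q ∉ D.accept) (j : Fin (L + 1)) :
    ((cascade D L M).δ (Sum.inl (Finite.equivFin σ q, j)) r).1 = Sum.inr false := by
  simp only [cascadeTransition, hr, Equiv.symm_apply_apply, hq, if_false]

end Transition

/-- The copy of `M b` inside `cascade`. -/
noncomputable def cascadeSubroutine (b : Bool) : Subroutine (cascade D L M) (M b) where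
  state q := Sum.inr ⟨b, q⟩
  tape k := some ⟨b, k⟩
  symbol := cascadeProj D L M b
  exit := cascadeExit L M b
  δ_status _ _ := rfl
  δ_tape _ _ k :=
    (congrArg (Prod.map (cascadeProj D L M b) id) (cascadeRun_apply b _ k)).trans
      (map_cascadeCell D L M b _ _)
  δ_other _ _ _ hj := cascadeRun_of_notMem_range _ hj

/-- `cascade` has transduced a part of its input: it is going to read the word `w`, has written the
words `l b` on its work tapes, and is in the state `(q, j)`. -/
structure CascadeScanning (C : (cascade D L M).Cfg) (q : σ) (j : Fin (L + 1)) (w : List X)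
    (l : ∀ b, List (Y b)) : Prop where
  status : C.status = Sum.inl (Sum.inl (Finite.equivFin σ q, j))
  input : ∃ T, C.tape none
    = Turing.Tape.mk' T (Turing.ListBlank.mk (w.map (cascade D L M).letter))
  output : ∀ b, (C.tape (some ⟨b, none⟩)).map (cascadeProj D L M b)
    = pushTape ((l b).map (M b).letter)
  work : ∀ b k, (C.tape (some ⟨b, some k⟩)).map (cascadeProj D L M b) = Turing.Tape.mk₁ []

theorem cascadeScanning_init (w : List X) :
    CascadeScanning D L M ((cascade D L M).init w) D.start (Fin.last L) w fun _ => [] where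
  status := rfl
  input := ⟨_, rfl⟩
  output b := (Turing.Tape.map_mk₁ (cascadeProj D L M b) []).trans pushTape_nil.symm
  work b _ := Turing.Tape.map_mk₁ (cascadeProj D L M b) []

namespace CascadeScanning

variable {D L M} {C : (cascade D L M).Cfg} {q : σ} {x : X} {w : List X} {l : ∀ b, List (Y b)}

theorem head_cons {j : Fin (L + 1)} (h : CascadeScanning D L M C q j (x :: w) l) :
    (C.tape none).head.1 = some (Finite.equivFin X x) := by
  obtain ⟨T, hT⟩ := h.input
  exact congrArg (fun T => T.head.1) hT

theorem head_nil {j : Fin (L + 1)} (h : CascadeScanning D L M C q j [] l) :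
    (C.tape none).head.1 = none := by
  obtain ⟨T, hT⟩ := h.input
  exact congrArg (fun T => T.head.1) hT

theorem step_emit {j : Fin L} (h : CascadeScanning D L M C q j.succ (x :: w) l) :
    CascadeScanning D L M ((cascade D L M).step C) q j.castSucc (x :: w)
      fun b => (D.emit b q x)[j.1]?.toList ++ l b := by
  obtain ⟨T, hT⟩ := h.input
  rw [step_eq _ h.status (δ_cascade_emit h.head_cons j)]
  refine ⟨rfl, ⟨T, (act_stay _ _).trans hT⟩, fun b => ?_,
    fun b k => (congrArg _ (act_stay _ _)).trans (h.work b k)⟩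
  rw [map_act _ (M b), h.output]
  exact (congrArg _ (map_cascadeCell D L M b _ _)).trans ((M b).act_pushTape _ _)

theorem step_next (h : CascadeScanning D L M C q 0 (x :: w) l) :
    CascadeScanning D L M ((cascade D L M).step C) (D.step q x) (Fin.last L) w l := by
  obtain ⟨T, hT⟩ := h.input
  rw [step_eq _ h.status (δ_cascade_next h.head_cons)]
  refine ⟨rfl, ⟨T.cons ((cascade D L M).letter x), ?_⟩,
    fun b => (congrArg _ (act_stay _ _)).trans (h.output b),
    fun b k => (congrArg _ (act_stay _ _)).trans (h.work b k)⟩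
  refine (show _ = (C.tape none).move Turing.Dir.right from act_move _ _ _).trans ?_
  rw [hT]
  exact Turing.Tape.move_right_mk' _ _

theorem iterate_step_emit (hL : ∀ b q x, (D.emit b q x).length ≤ L)
    (h : CascadeScanning D L M C q (Fin.last L) (x :: w) l) (n : ℕ) (j : Fin (L + 1))
    (hj : j.1 + n = L) :
    CascadeScanning D L M ((cascade D L M).step^[n] C) q j (x :: w)
      fun b => (D.emit b q x).drop j ++ l b := by
  induction n generalizing j with
  | zero =>
    obtain rfl : j = Fin.last L := Fin.ext hj
    simpa only [Fin.val_last, List.drop_of_length_le (hL _ q x), List.nil_append,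
      Function.iterate_zero_apply] using h
  | succ n ih =>
    obtain ⟨j, rfl⟩ : ∃ i : Fin L, i.castSucc = j := ⟨⟨j, by omega⟩, rfl⟩
    rw [Fin.val_castSucc] at hj
    have hstep := (ih j.succ ((Nat.succ_add_eq_add_succ j n).trans hj)).step_emit
    simpa only [← List.append_assoc, Fin.val_succ, Fin.val_castSucc, Function.iterate_succ_apply',
      ← List.drop_eq_getElem?_toList_append] using hstep

theorem iterate_step_letter (hL : ∀ b q x, (D.emit b q x).length ≤ L)
    (h : CascadeScanning D L M C q (Fin.last L) (x :: w) l) :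
    CascadeScanning D L M ((cascade D L M).step^[L + 1] C) (D.step q x) (Fin.last L) w
      fun b => D.emit b q x ++ l b := by
  rw [Function.iterate_succ_apply']
  exact (h.iterate_step_emit hL L 0 (Nat.zero_add L)).step_next

theorem iterate_step_word (hL : ∀ b q x, (D.emit b q x).length ≤ L)
    (h : CascadeScanning D L M C q (Fin.last L) w l) :
    CascadeScanning D L M ((cascade D L M).step^[(L + 1) * w.length] C) (D.evalFrom q w)
      (Fin.last L) [] fun b => D.outputFrom b q w ++ l b := by
  induction w generalizing C q l with
  | nil => exact h
  | cons x w ih =>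
    rw [List.length_cons, Nat.mul_succ, Function.iterate_add_apply]
    simpa only [Transducer.outputFrom, DFA.evalFrom_cons, List.append_assoc] using
      ih (h.iterate_step_letter hL)

theorem status_step_of_notMem {j : Fin (L + 1)} (h : CascadeScanning D L M C q j [] l)
    (hq : q ∉ D.accept) : ((cascade D L M).step C).status = Sum.inr false := by
  rw [step_eq _ h.status rfl]
  exact δ_cascade_reject h.head_nil hq j

theorem step_rewind {j : Fin (L + 1)} (h : CascadeScanning D L M C q j [] l)
    (hq : q ∈ D.accept) :
    ((cascade D L M).step C).status = Sum.inl (Sum.inr ⟨false, (M false).start⟩) ∧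
      ∀ b k, (((cascade D L M).step C).tape (some ⟨b, k⟩)).map (cascadeProj D L M b)
        = ((M b).init (l b)).tape k := by
  rw [step_eq _ h.status (δ_cascade_rewind h.head_nil hq j)]
  refine ⟨rfl, fun b k => ?_⟩
  cases k with
  | none =>
    refine (congrArg (Turing.Tape.map _) (act_move _ _ _)).trans ?_
    rw [Turing.Tape.map_move, h.output, pushTape_move_right]
    rfl
  | some k => exact (congrArg _ (act_stay _ _)).trans (h.work b k)

end CascadeScanning

section Run

variable {D L M} {w : List X} {v : Bool} {s t : ℕ}

theorem cascadeScanning_iterate_step (hL : ∀ b q x, (D.emit b q x).length ≤ L) (w : List X) :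
    CascadeScanning D L M ((cascade D L M).step^[(L + 1) * w.length] ((cascade D L M).init w))
      (D.eval w) (Fin.last L) [] fun b => D.output b w := by
  simpa only [List.append_nil, Transducer.output, DFA.eval] using
    (cascadeScanning_init D L M w).iterate_step_word hL

theorem cascade_haltsWith_of_notMem (hL : ∀ b q x, (D.emit b q x).length ≤ L)
    (hw : w ∉ D.accepts) :
    (cascade D L M).HaltsWith w false ((L + 1) * w.length + 1) := by
  rw [HaltsWith, run, Function.iterate_succ_apply']
  exact (cascadeScanning_iterate_step hL w).status_step_of_notMem hw

theorem exists_run_cascade_of_mem (hL : ∀ b q x, (D.emit b q x).length ≤ L)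
    (hw : w ∈ D.accepts) (hs : (M false).HaltsWith (D.output false w) v s) :
    ∃ s' ≤ s, ((cascade D L M).run w ((L + 1) * w.length + 1 + s')).status
        = cascadeExit L M false v ∧
      ∀ k, (((cascade D L M).run w ((L + 1) * w.length + 1 + s')).tape (some ⟨true, k⟩)).map
        (cascadeProj D L M true) = ((M true).init (D.output true w)).tape k := by
  obtain ⟨hstatus, htape⟩ := (cascadeScanning_iterate_step (M := M) hL w).step_rewind hw
  rw [← Function.iterate_succ_apply' (cascade D L M).step] at hstatus htape
  have hsim : (cascadeSubroutine D L M false).Simulates _ ((M false).init (D.output false w)) :=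
    ⟨hstatus, htape false⟩
  obtain ⟨s', hs', hsim', hother⟩ := hsim.exists_iterate_step s
  refine ⟨s', hs', ?_⟩
  rw [run, Nat.add_comm, Function.iterate_add_apply]
  refine ⟨hsim'.status.trans (congrArg (Sum.elim _ _) hs), fun k => ?_⟩
  exact (congrArg _ (hother _ (by simp [cascadeSubroutine]))).trans (htape true k)

theorem cascade_haltsWith_of_haltsWith_false (hL : ∀ b q x, (D.emit b q x).length ≤ L)
    (hw : w ∈ D.accepts) (hs : (M false).HaltsWith (D.output false w) false s) :
    (cascade D L M).HaltsWith w false ((L + 1) * w.length + 1 + s) := by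
  obtain ⟨s', hs', hstatus, -⟩ := exists_run_cascade_of_mem hL hw hs
  exact HaltsWith.mono hstatus (Nat.add_le_add_left hs' _)

theorem cascade_haltsWith_of_haltsWith_true (hL : ∀ b q x, (D.emit b q x).length ≤ L)
    (hw : w ∈ D.accepts) (hs : (M false).HaltsWith (D.output false w) true s)
    (ht : (M true).HaltsWith (D.output true w) v t) :
    (cascade D L M).HaltsWith w v ((L + 1) * w.length + 1 + s + t) := by
  obtain ⟨s', hs', hstatus, htape⟩ := exists_run_cascade_of_mem hL hw hs
  have hsim : (cascadeSubroutine D L M true).Simulates _ ((M true).init (D.output true w)) :=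
    ⟨hstatus, htape⟩
  obtain ⟨t', ht', hsim', -⟩ := hsim.exists_iterate_step t
  have hhalts : (cascade D L M).HaltsWith w v ((L + 1) * w.length + 1 + s' + t') := by
    rw [HaltsWith, run, Nat.add_comm _ t', Function.iterate_add_apply]
    exact hsim'.status.trans (congrArg (Sum.elim _ _) ht)
  exact hhalts.mono (by omega)

variable {K : ∀ b, Language (Y b)}

open Classical in
theorem exists_cascade_haltsWith (hL : ∀ b q x, (D.emit b q x).length ≤ L)
    (hM : ∀ b, (M b).Decides (K b)) (w : List X) :
    ∃ t : ℕ, (cascade D L M).HaltsWith w (decide ((w ∈ D.accepts ∧ D.output false w ∈ K false) ∧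
        D.output true w ∈ K true)) t ∧
      t ≤ ((L + 1) * w.length + 1 : ℕ) + (M false).time (D.output false w) +
        if w ∈ D.accepts ∧ D.output false w ∈ K false then (M true).time (D.output true w)
        else 0 := by
  simp only [decides_iff] at hM
  obtain ⟨s₀, hs₀⟩ := hM false (D.output false w)
  obtain ⟨s, hs_eq, hs⟩ := hs₀.exists_time_eq
  obtain ⟨t₀, ht₀⟩ := hM true (D.output true w)
  obtain ⟨t, ht_eq, ht⟩ := ht₀.exists_time_eq
  rw [hs_eq, ht_eq]
  by_cases hw : w ∈ D.accepts
  · by_cases hK : D.output false w ∈ K false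
    · simp only [hK, decide_true] at hs
      simp only [hw, hK, and_self, true_and, if_true]
      exact ⟨_, cascade_haltsWith_of_haltsWith_true hL hw hs ht, by norm_cast⟩
    · simp only [hK, decide_false] at hs
      simp only [hK, and_false, false_and, decide_false, if_false]
      exact ⟨_, cascade_haltsWith_of_haltsWith_false hL hw hs, by norm_cast⟩
  · simp only [hw, false_and, decide_false, if_false]
    exact ⟨_, cascade_haltsWith_of_notMem hL hw, by norm_cast; omega⟩

theorem cascade_decides (hL : ∀ b q x, (D.emit b q x).length ≤ L)
    (hM : ∀ b, (M b).Decides (K b)) :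
    (cascade D L M).Decides
      {w | (w ∈ D.accepts ∧ D.output false w ∈ K false) ∧ D.output true w ∈ K true} :=
  decides_iff.2 fun w =>
    let ⟨t, ht, _⟩ := exists_cascade_haltsWith hL hM w
    ⟨t, by convert ht; rfl⟩

open Classical in
theorem cascade_time_le (hL : ∀ b q x, (D.emit b q x).length ≤ L)
    (hM : ∀ b, (M b).Decides (K b)) (w : List X) :
    (cascade D L M).time w ≤
      ((L + 1) * w.length + 1 : ℕ) + (M false).time (D.output false w) +
        if w ∈ D.accepts ∧ D.output false w ∈ K false then (M true).time (D.output true w)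
        else 0 :=
  let ⟨_, ht, hle⟩ := exists_cascade_haltsWith hL hM w
  ht.time_le.trans hle

end Run

end Cascade

end MultiTapeTM

/-! ### The machine for the word problem -/

theorem IsGeneratingFamily.exists_word {A G : Type*} [Group G] {π : A → G}
    (hπ : IsGeneratingFamily π) (g : G) :
    ∃ l : List (A × Bool), FreeGroup.lift π (FreeGroup.mk l) = g := by
  have hg : g ∈ (FreeGroup.lift π).range := by
    rw [FreeGroup.range_lift_eq_closure, show Subgroup.closure (Set.range π) = ⊤ from hπ]
    exact Subgroup.mem_top g
  obtain ⟨v, rfl⟩ := hg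
  obtain ⟨l, rfl⟩ := Quot.exists_rep v
  exact ⟨l, rfl⟩

/-- A word for `g` in the letters of a generating family. -/
noncomputable def IsGeneratingFamily.wordOf {A G : Type*} [Group G] {π : A → G}
    (hπ : IsGeneratingFamily π) (g : G) : List (A × Bool) :=
  (hπ.exists_word g).choose

theorem IsGeneratingFamily.lift_mk_wordOf {A G : Type*} [Group G] {π : A → G}
    (hπ : IsGeneratingFamily π) (g : G) : FreeGroup.lift π (FreeGroup.mk (hπ.wordOf g)) = g :=
  (hπ.exists_word g).choose_spec

theorem mem_wordProblem {A G : Type*} [Group G] {π : A → G} {w : List (A × Bool)} :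
    w ∈ wordProblem π ↔ FreeGroup.lift π (FreeGroup.mk w) = 1 :=
  Iff.rfl

section Cocycle

variable {G : Type*} [Group G] (H : Subgroup G)

/-- The cocycle of the action of `G` on `G ⧸ H`: the factor in `H` by which `g` moves the
representative of the coset `i`. -/
noncomputable def cosetCocycle (g : G) (i : G ⧸ H) : H :=
  ⟨(g • i).out⁻¹ * (g * i.out), QuotientGroup.eq.1 <| by
    rw [QuotientGroup.out_eq', ← smul_eq_mul, ← MulAction.Quotient.smul_coe,
      QuotientGroup.out_eq']⟩

theorem cosetCocycle_one (i : G ⧸ H) : cosetCocycle H 1 i = 1 := by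
  refine Subtype.ext ?_
  simp only [cosetCocycle, one_smul, one_mul, inv_mul_cancel, Subgroup.coe_one]

theorem cosetCocycle_mul (g h : G) (i : G ⧸ H) :
    cosetCocycle H (g * h) i = cosetCocycle H g (h • i) * cosetCocycle H h i := by
  refine Subtype.ext ?_
  simp only [cosetCocycle, Subgroup.coe_mul, mul_smul]
  group

theorem isConj_cosetCocycle_one (h : H) : IsConj (cosetCocycle H h (1 : G)) h := by
  have hout : ((1 : G) : G ⧸ H).out ∈ H := by
    simpa using QuotientGroup.eq.1 (QuotientGroup.out_eq' ((1 : G) : G ⧸ H)).symm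
  have hsmul : (h : G) • ((1 : G) : G ⧸ H) = (1 : G) :=
    QuotientGroup.eq.2 (by simp)
  refine isConj_iff.2 ⟨⟨_, hout⟩, Subtype.ext ?_⟩
  simp only [cosetCocycle, hsmul, Subgroup.coe_mul, Subgroup.coe_inv]
  group

theorem map_cosetCocycle_one_eq_one_iff {Q : Type*} [Group Q] (φ : H →* Q) (h : H) :
    φ (cosetCocycle H h (1 : G)) = 1 ↔ φ h = 1 := by
  have hconj := φ.map_isConj (isConj_cosetCocycle_one H h)
  exact ⟨fun h => isConj_one_right.1 (h ▸ hconj), fun h => isConj_one_left.1 (h ▸ hconj)⟩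

end Cocycle

section Transducer

variable {G : Type*} [Group G] {H : Subgroup G} {Q : Type*} [Group Q] (φ : H →* Q)
  {A : Type*} (π : A → G) {B : Bool → Type*} {ρ : B false → Q} (hρ : IsGeneratingFamily ρ)
  {σ : B true → G} (hσ : IsGeneratingFamily σ)

/-- The transducer that, on reading a word for `g`, moves from the coset `i` to `g⁻¹ • i` and puts
out words for the image in `Q` of the cocycle of `g⁻¹` and for `g⁻¹` itself. -/
noncomputable def cosetTransducer : Transducer (A × Bool) (G ⧸ H) fun b => B b × Bool where
  step i s := (FreeGroup.lift π (signedLetter s))⁻¹ • i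
  start := (1 : G)
  accept := {((1 : G) : G ⧸ H)}
  emit
    | false, i, s => hρ.wordOf (φ (cosetCocycle H (FreeGroup.lift π (signedLetter s))⁻¹ i))
    | true, _, s => hσ.wordOf (FreeGroup.lift π (signedLetter s))⁻¹

theorem evalFrom_cosetTransducer (i : G ⧸ H) (w : List (A × Bool)) :
    (cosetTransducer φ π hρ hσ).evalFrom i w = (FreeGroup.lift π (FreeGroup.mk w))⁻¹ • i := by
  induction w generalizing i with
  | nil => simp only [DFA.evalFrom_nil, ← FreeGroup.one_eq_mk, map_one, inv_one, one_smul]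
  | cons s w ih =>
    rw [DFA.evalFrom_cons, ih, mk_cons, map_mul, mul_inv_rev, mul_smul]
    rfl

theorem lift_mk_outputFrom_false_cosetTransducer (i : G ⧸ H) (w : List (A × Bool)) :
    FreeGroup.lift ρ (FreeGroup.mk ((cosetTransducer φ π hρ hσ).outputFrom false i w))
      = φ (cosetCocycle H (FreeGroup.lift π (FreeGroup.mk w))⁻¹ i) := by
  induction w generalizing i with
  | nil =>
    simp only [Transducer.outputFrom, ← FreeGroup.one_eq_mk, map_one, inv_one, cosetCocycle_one]
  | cons s w ih =>
    rw [Transducer.outputFrom, ← FreeGroup.mul_mk, map_mul, ih, mk_cons, map_mul, mul_inv_rev,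
      cosetCocycle_mul, map_mul]
    exact congrArg _ (hρ.lift_mk_wordOf _)

theorem lift_mk_outputFrom_true_cosetTransducer (i : G ⧸ H) (w : List (A × Bool)) :
    FreeGroup.lift σ (FreeGroup.mk ((cosetTransducer φ π hρ hσ).outputFrom true i w))
      = (FreeGroup.lift π (FreeGroup.mk w))⁻¹ := by
  induction w generalizing i with
  | nil => simp only [Transducer.outputFrom, ← FreeGroup.one_eq_mk, map_one, inv_one]
  | cons s w ih =>
    rw [Transducer.outputFrom, ← FreeGroup.mul_mk, map_mul, ih, mk_cons, map_mul, mul_inv_rev]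
    exact congrArg _ (hσ.lift_mk_wordOf _)

theorem output_true_cosetTransducer_mem_wordProblem {w : List (A × Bool)} :
    (cosetTransducer φ π hρ hσ).output true w ∈ wordProblem σ ↔ w ∈ wordProblem π := by
  rw [mem_wordProblem, mem_wordProblem, Transducer.output,
    lift_mk_outputFrom_true_cosetTransducer, inv_eq_one]

theorem mem_accepts_cosetTransducer_and_iff {w : List (A × Bool)} :
    w ∈ (cosetTransducer φ π hρ hσ).accepts ∧
        (cosetTransducer φ π hρ hσ).output false w ∈ wordProblem ρ ↔
      FreeGroup.lift π (FreeGroup.mk w) ∈ φ.ker.map H.subtype := by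
  have haccepts : w ∈ (cosetTransducer φ π hρ hσ).accepts ↔
      FreeGroup.lift π (FreeGroup.mk w) ∈ H := by
    rw [DFA.mem_accepts, DFA.eval, evalFrom_cosetTransducer]
    exact QuotientGroup.eq.trans (by simp)
  rw [haccepts, mem_wordProblem, Transducer.output, lift_mk_outputFrom_false_cosetTransducer]
  generalize FreeGroup.lift π (FreeGroup.mk w) = g
  have hcoe (h : H) :
      φ (cosetCocycle H (h : G)⁻¹ (1 : G)) = 1 ↔ (h : G) ∈ φ.ker.map H.subtype := by
    rw [coe_mem_map_subtype_ker, ← inv_eq_one (a := φ h), ← map_inv]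
    exact map_cosetCocycle_one_eq_one_iff H φ h⁻¹
  refine ⟨fun ⟨hg, hφg⟩ => (hcoe ⟨g, hg⟩).1 hφg, fun hg => ?_⟩
  have hgH : g ∈ H := Subgroup.map_subtype_le _ hg
  exact ⟨hgH, (hcoe ⟨g, hgH⟩).2 hg⟩

theorem mul_add_one_add_le {f : ℕ → ℕ} (hf : Monotone f) (hle : ∀ n, n ≤ f n) (L n : ℕ) :
    (L + 1) * n + 1 + f (L * n) ≤ (L + 2) * f ((L + 2) * n + (L + 2)) + (L + 2) := by
  have hself : (L + 2) * n + (L + 2) ≤ f ((L + 2) * n + (L + 2)) := hle _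
  have hmono : f (L * n) ≤ f ((L + 2) * n + (L + 2)) := hf (by nlinarith)
  nlinarith [Nat.zero_le (L * f ((L + 2) * n + (L + 2)))]

end Transducer

universe u in
open Classical in
/-- Membership in the kernel of `φ` is decided first, and the slow machine for the word problem of
`G` runs only on the words that pass this test. -/
theorem exists_decides_wordProblem_time_le {G : Type*} [Group G] {H : Subgroup G} [H.FiniteIndex]
    {Q : Type*} [Group Q] (φ : H →* Q) {A : Type*} [Finite A] (π : A → G) {B₁ B₂ : Type u}
    {ρ : B₁ → Q} {σ : B₂ → G} (hρ : IsGeneratingFamily ρ) (hσ : IsGeneratingFamily σ)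
    {M₁ : MultiTapeTM (B₁ × Bool)} (hM₁ : M₁.Decides (wordProblem ρ)) {f : ℕ → ℕ} (hf : Monotone f)
    (hle : ∀ n, n ≤ f n) (hf₁ : ∀ w, M₁.time w ≤ (f w.length : ℕ∞))
    {M₂ : MultiTapeTM (B₂ × Bool)} (hM₂ : M₂.Decides (wordProblem σ)) :
    ∃ (M : MultiTapeTM (A × Bool)) (L : ℕ), M.Decides (wordProblem π) ∧
      ∀ w, ∃ w₂ : List (B₂ × Bool), w₂.length ≤ L * w.length ∧
        M.time w ≤ ((L + 2) * f ((L + 2) * w.length + (L + 2)) + (L + 2) : ℕ) +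
          if FreeGroup.lift π (FreeGroup.mk w) ∈ φ.ker.map H.subtype then M₂.time w₂ else 0 := by
  obtain ⟨B, rfl, rfl⟩ : ∃ B : Bool → Type u, B false = B₁ ∧ B true = B₂ :=
    ⟨Bool.rec B₁ B₂, rfl, rfl⟩
  let D := cosetTransducer φ π hρ hσ
  obtain ⟨L, hL⟩ := D.exists_length_emit_le
  let M : ∀ b, MultiTapeTM (B b × Bool) := Bool.rec M₁ M₂
  let K : ∀ b, Language (B b × Bool) := Bool.rec (wordProblem ρ) (wordProblem σ)
  have hM : ∀ b, (M b).Decides (K b) := Bool.rec hM₁ hM₂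
  have hlang : {w | (w ∈ D.accepts ∧ D.output false w ∈ K false) ∧ D.output true w ∈ K true}
      = wordProblem π := by
    ext w
    have hmem : w ∈ wordProblem π → FreeGroup.lift π (FreeGroup.mk w) ∈ φ.ker.map H.subtype :=
      fun hw => (mem_wordProblem.1 hw).symm ▸ Subgroup.one_mem _
    exact (and_congr (mem_accepts_cosetTransducer_and_iff φ π hρ hσ)
      (output_true_cosetTransducer_mem_wordProblem φ π hρ hσ)).trans (and_iff_right_of_imp hmem)
  refine ⟨MultiTapeTM.cascade D L M, L, hlang ▸ MultiTapeTM.cascade_decides hL hM, fun w =>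
    ⟨D.output true w, D.length_outputFrom_le (hL true) _ w, ?_⟩⟩
  have htime := MultiTapeTM.cascade_time_le hL hM w
  have hM₁_time : M₁.time (D.output false w) ≤ (f (L * w.length) : ℕ) :=
    (hf₁ _).trans (Nat.cast_le.2 (hf (D.length_outputFrom_le (hL false) _ w)))
  simp only [← mem_accepts_cosetTransducer_and_iff φ π hρ hσ]
  refine htime.trans (add_le_add_left ?_ _)
  refine (add_le_add_right hM₁_time _).trans ?_
  exact_mod_cast mul_add_one_add_le hf hle L w.length

theorem theoremE_general {G : Type*} [Group G] (hG : HasWordProblemIn G SubExp)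
    (𝓕 : Set (ℕ → ℕ)) (h𝓕 : IsTimeFamily 𝓕) (H : Subgroup G) [H.FiniteIndex]
    {Q : Type*} [Group Q] (φ : H →* Q) (hφ : Function.Surjective φ)
    (hQ : ¬ IsAmenableGroup Q) (hQ_word : HasWordProblemIn Q (DTime 𝓕))
    {A : Type*} [Finite A] [DecidableEq A] (π : A → G) (hπ : IsGeneratingFamily π) :
    ∃ M : MultiTapeTM (A × Bool), ∃ f ∈ 𝓕,
      M.SolvesOnAverage (wordProblem π) f {μ | IsLengthInvariant μ} := by
  obtain ⟨n, σ, hσ, g, hg, M₂, hM₂, hg₂⟩ := hG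
  obtain ⟨m, ρ, hρ, f, hf, M₁, hM₁, hf₁⟩ := hQ_word
  obtain ⟨M, L, hM, htime⟩ := exists_decides_wordProblem_time_le φ π hρ hσ hM₁
    (h𝓕.monotone f hf) (h𝓕.le_self f hf) hf₁ hM₂
  have hF : (fun n => (L + 2) * f ((L + 2) * n + (L + 2)) + (L + 2)) ∈ 𝓕 :=
    h𝓕.closed f hf (L + 2) (Nat.le_add_left 1 (L + 1))
  refine ⟨M, _, hF, hM.solvesOnAverage_of_time_le hπ (hasBoundedDoubling_quotient_map_ker hφ
    (hasBoundedDoubling_of_not_isAmenableGroup hQ)) (h𝓕.monotone _ hF)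
    (fun _ => Nat.succ_pos _) hg L fun v => ?_⟩
  obtain ⟨w, hw, hle⟩ := htime v.toWord
  refine ⟨w.length, hw, (ENat.toENNReal_le.2 hle).trans ?_⟩
  rw [FreeGroup.mk_toWord, ENat.toENNReal_add, ENat.toENNReal_coe]
  refine add_le_add_right ?_ _
  split_ifs
  · exact hg₂ w
  · exact ENat.toENNReal_zero.le

theorem theoremE {G : Type*} [Group G] [Group.IsFinitelyPresented G]
    (hG : HasWordProblemIn G SubExp)
    (𝓕 : Set (ℕ → ℕ)) (h𝓕 : IsTimeFamily 𝓕) (h𝓕_subExp : DTime 𝓕 ≤ SubExp)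
    (H : Subgroup G) [H.FiniteIndex]
    {Q : Type*} [Group Q] (φ : H →* Q) (hφ : Function.Surjective φ)
    (hQ : ¬ IsAmenableGroup Q) (hQ_word : HasWordProblemIn Q (DTime 𝓕))
    {A : Type*} [Finite A] [DecidableEq A] (π : A → G) (hπ : IsGeneratingFamily π) :
    ∃ M : MultiTapeTM (A × Bool), ∃ f ∈ 𝓕,
      M.SolvesOnAverage (wordProblem π) f {μ | IsLengthInvariant μ} :=
  theoremE_general hG 𝓕 h𝓕 H φ hφ hQ hQ_word π hπ
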